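/- **Setting.** Let $(X,d,\mu)$ be a complete metric space with a Borel measure $\mu$ that is doubling with constant $C_\mu\ge 1$, i.e. $0<\mu(B_r(x))<\infty$ and $\mu(B_{2r}(x))\le C_\mu\,\mu(B_r(x))$ for all $x\in X$, $r>0$ ($B_r(x)$ is the open ball), and that supports a weak $(1,1)$-Poincaré inequality: there are $C_P>0$, $\tau\ge1$ with $\frac1{\mu(B_r(x))}\int_{B_r(x)}|f-f_{B_r(x)}|\,d\mu\le \frac{C_P\,r}{\mu(B_{\tau r}(x))}\int_{B_{\tau r}(x)}g\,d\mu$ (where $f_B$ is the mean value of $f$ over $B$) for all balls, all $f\in L^1_{\rm loc}(X)$ and all upper gradients $g$ of $f$. Let $\Omega\subset X$ be open, $0<T<\infty$, $\Omega_T=\Omega\times(0,T)$; $A\Subset B$ means that $\overline A$ is a compact subset of $B$. For an open set $U$ the total variation is $$\|Df\|(U)=\inf\Big\{\liminf_{i\to\infty}\int_U g_{f_i}\,d\mu:\ f_i\in{\rm Lip}_{\rm loc}(U),\ f_i\to f\text{ in }L^1_{\rm loc}(U)\Big\},$$ with $g_{f_i}$ a $1$-weak upper gradient of $f_i$ in $U$,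 and $BV(U)$ consists of the $f\in L^1(U)$ with $\|Df\|(U)<\infty$. $L^1_{\rm loc}(0,T;BV_{\rm loc}(\Omega))$ consists of the $\mu\otimes\mathcal L^1$-measurable $u$ on $\Omega_T$ such that for every open $\Omega'\Subset\Omega$ and $0<t_1<t_2<T$ one has $u(t)=u(\cdot,t)\in BV(\Omega')$ for a.e. $t\in(t_1,t_2)$ and $\int_{t_1}^{t_2}\big(\|u(t)\|_{L^1(\Omega')}+\|Du(t)\|(\Omega')\big)dt<\infty$. **De Giorgi class.** For $\gamma>0$, $u\in DG^-(\Omega_T;\gamma)$ means: $u\in L^1_{\rm loc}(0,T;BV_{\rm loc}(\Omega))$ is real-valued and defined at every time, $(u(t)-k)_-\in L^2(\Omega')$ for all $t\in(0,T)$, $k\in\mathbb R$ and open $\Omega'\Subset\Omega$, and for every $Q=B_r(y)\times(s-\theta r,s]\Subset\Omega_T$ with $r,\theta>0$, every $k\in\mathbb R$ and every $\varphi\in{\rm Lip}(\Omega_T)$ with $\operatorname{supp}\varphi\Subset B_r(y)\times(0,T)$ and $0\le\varphi\le1$, with $E(t)=\int_{B_r(y)}\varphi(t)(u(t)-k)_-^2\,d\mu$,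 $$\max\Big\{\operatorname*{ess\,sup}_{s-\theta r\le t\le s}E(t),\,E(s)\Big\}+\int_{s-\theta r}^{s}\|D(\varphi(u-k)_-)(t)\|(B_r(y))\,dt$$ $$\le\gamma\iint_{Q}\Big|\frac{\partial\varphi}{\partial t}\Big|(u-k)_-^2\,d\mu\,dt+\gamma\iint_{Q}g_{\varphi}\,(u-k)_-\,d\mu\,dt+E(s-\theta r),$$ where $g_\varphi(t)$ is the minimal $1$-weak upper gradient of $\varphi(t)$ and $(a)_-=\max\{-a,0\}$. **Lemma.** There is $\varepsilon\in(0,1)$ and, for all $C_\mu\ge1$ and $\gamma>0$, there is $\delta=\delta(C_\mu,\gamma)\in(0,1)$ such that the following holds for all $(X,d,\mu)$, $\Omega$, $T$ as above and all $u\in DG^-(\Omega_T;\gamma)$. Let $(x_0,t_0)\in\Omega_T$, $\rho>0$, $\xi\in(0,1)$, and let $m_+,m_-,\omega\in\mathbb R$ be such that, for $\theta=\delta\xi\omega$, the cylinder $Q^+=B_{2\rho}(x_0)\times(t_0,t_0+\theta\rho)$ is contained in $\Omega_T$ and $$m_+\ge\operatorname*{ess\,sup}_{Q^+}u,\qquad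 m_-\le\operatorname*{ess\,inf}_{Q^+}u,\qquad \omega\ge m_+-m_-.$$ If $$\mu(\{x\in B_\rho(x_0):u(x,t_0)\ge m_-+\xi\omega\})\ge\tfrac12\,\mu(B_\rho(x_0)),$$ then $$\mu(\{x\in B_\rho(x_0):u(x,t)\ge m_-+\varepsilon\xi\omega\})\ge\tfrac14\,\mu(B_\rho(x_0))\qquad\text{for every }t\in(t_0,t_0+\delta\xi\omega\rho).$$ -/

import Mathlib

open Set Filter Topology MeasureTheory Metric
open scoped ENNReal NNReal

noncomputable section

namespace MetricTV

/-! ### Curves, upper gradients, modulus -/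

/-- A compact rectifiable curve in the set `U`, parametrized by arc length on `[0, len]`. -/
structure RectCurve {X : Type*} [MetricSpace X] (U : Set X) where
  len : ℝ
  len_nonneg : 0 ≤ len
  toFun : ℝ → X
  unitSpeed : HasUnitSpeedOn toFun (Icc 0 len)
  mapsTo : MapsTo toFun (Icc 0 len) U

/-- The line integral `∫_c g ds`. -/
def RectCurve.lineIntegral {X : Type*} [MetricSpace X] {U : Set X} (c : RectCurve U)
    (g : X → ℝ≥0∞) : ℝ≥0∞ :=
  ∫⁻ s in Icc 0 c.len, g (c.toFun s)

/-- The upper gradient inequality of the pair `(f, g)` along the curve `c`. -/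
def RectCurve.UpperGradientIneq {X : Type*} [MetricSpace X] {U : Set X} (c : RectCurve U)
    (g : X → ℝ≥0∞) (f : X → ℝ) : Prop :=
  ENNReal.ofReal |f (c.toFun 0) - f (c.toFun c.len)| ≤ c.lineIntegral g

/-- The `1`-modulus of a family `Γ` of curves in `U`. -/
def modulusOne {X : Type*} [MetricSpace X] [MeasurableSpace X] (μ : Measure X) {U : Set X}
    (Γ : Set (RectCurve U)) : ℝ≥0∞ :=
  ⨅ (h : X → ℝ≥0∞) (_ : Measurable h) (_ : ∀ c ∈ Γ, 1 ≤ c.lineIntegral h),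
    ∫⁻ x in U, h x ∂μ

/-- `g` is an upper gradient of `f` in `U`. Non-rectifiable curves impose no condition, since
the line integral over them is infinite. -/
def IsUpperGradient {X : Type*} [MetricSpace X] [MeasurableSpace X] (U : Set X)
    (g : X → ℝ≥0∞) (f : X → ℝ) : Prop :=
  Measurable g ∧ ∀ c : RectCurve U, c.UpperGradientIneq g f

/-- `g` is a `1`-weak upper gradient of `f` in `U`: the upper gradient inequality holds outside
a family of curves of zero `1`-modulus. -/
def IsWeakUpperGradient {X : Type*} [MetricSpace X] [MeasurableSpace X] (μ : Measure X)
    (U : Set X) (g : X → ℝ≥0∞) (f : X → ℝ) : Prop :=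
  Measurable g ∧ modulusOne μ {c : RectCurve U | ¬ c.UpperGradientIneq g f} = 0

/-! ### Standing assumptions on the space -/

/-- `μ` is doubling with doubling constant `Cμ`; balls have positive and finite measure. -/
def IsDoubling {X : Type*} [MetricSpace X] [MeasurableSpace X] (μ : Measure X) (Cμ : ℝ) : Prop :=
  ∀ (x : X) (r : ℝ), 0 < r →
    0 < μ (ball x r) ∧ μ (ball x r) < ∞ ∧ μ (ball x (2 * r)) ≤ ENNReal.ofReal Cμ * μ (ball x r)

/-- `(X, d, μ)` supports a weak `(1,1)`-Poincaré inequality. -/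
def SupportsPoincare {X : Type*} [MetricSpace X] [MeasurableSpace X] (μ : Measure X) : Prop :=
  ∃ CP τ : ℝ, 0 < CP ∧ 1 ≤ τ ∧
    ∀ (x : X) (r : ℝ), 0 < r → ∀ (f : X → ℝ) (g : X → ℝ≥0∞),
      LocallyIntegrable f μ → IsUpperGradient univ g f →
      (⨍⁻ y in ball x r, ENNReal.ofReal |f y - ⨍ z in ball x r, f z ∂μ| ∂μ)
        ≤ ENNReal.ofReal (CP * r) * ⨍⁻ y in ball x (τ * r), g y ∂μ

/-! ### Functions of bounded variation -/

/-- `A ⋐ B`: the closure of `A` is a compact subset of `B`. -/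
def CompactlyIn {Y : Type*} [TopologicalSpace Y] (A B : Set Y) : Prop :=
  IsCompact (closure A) ∧ closure A ⊆ B

/-- `f` is Lipschitz continuous on every compact subset of `U`. -/
def LipLoc {X : Type*} [MetricSpace X] (U : Set X) (f : X → ℝ) : Prop :=
  ∀ K ⊆ U, IsCompact K → ∃ C : ℝ≥0, LipschitzOnWith C f K

/-- `F i → f` in `L¹_loc(U)`. -/
def TendstoL1Loc {X : Type*} [MetricSpace X] [MeasurableSpace X] (μ : Measure X) (U : Set X)
    (F : ℕ → X → ℝ) (f : X → ℝ) : Prop :=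
  ∀ K ⊆ U, IsCompact K →
    Tendsto (fun i => ∫⁻ x in K, ENNReal.ofReal |F i x - f x| ∂μ) atTop (𝓝 0)

/-- The total variation `‖Df‖(U)` in an open set `U`, by relaxation: the infimum of
`liminf ∫_U g_i dμ` over locally Lipschitz `F i → f` in `L¹_loc(U)` and `1`-weak upper gradients
`g_i` of `F i`. -/
def totalVariation {X : Type*} [MetricSpace X] [MeasurableSpace X] (μ : Measure X)
    (f : X → ℝ) (U : Set X) : ℝ≥0∞ :=
  ⨅ (F : ℕ → X → ℝ) (g : ℕ → X → ℝ≥0∞) (_ : ∀ i, LipLoc U (F i))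
    (_ : ∀ i, IsWeakUpperGradient μ U (g i) (F i)) (_ : TendstoL1Loc μ U F f),
    liminf (fun i => ∫⁻ x in U, g i x ∂μ) atTop

/-- `f ∈ BV(U)`. -/
def MemBV {X : Type*} [MetricSpace X] [MeasurableSpace X] (μ : Measure X)
    (f : X → ℝ) (U : Set X) : Prop :=
  IntegrableOn f U μ ∧ totalVariation μ f U < ∞

/-- The space-time cylinder `Ω_T = Ω × (0, T)`. -/
def spaceTime {X : Type*} (Ω : Set X) (T : ℝ) : Set (X × ℝ) := Ω ×ˢ Ioo 0 T

/-- `u ∈ L¹_loc(0, T; BV_loc(Ω))`. The value of `u` at the point `x` and the time `t` is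
`u x t`. -/
structure MemL1LocBVLoc {X : Type*} [MetricSpace X] [MeasurableSpace X] (μ : Measure X)
    (Ω : Set X) (T : ℝ) (u : X → ℝ → ℝ) : Prop where
  aestronglyMeasurable :
    AEStronglyMeasurable (fun p : X × ℝ => u p.1 p.2)
      ((μ.prod volume).restrict (spaceTime Ω T))
  memBV : ∀ Ω' : Set X, IsOpen Ω' → CompactlyIn Ω' Ω → ∀ t₁ t₂ : ℝ, 0 < t₁ → t₁ < t₂ → t₂ < T →
    ∀ᵐ t ∂(volume.restrict (Ioo t₁ t₂)), MemBV μ (fun x => u x t) Ω'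
  lintegral_lt_top : ∀ Ω' : Set X, IsOpen Ω' → CompactlyIn Ω' Ω →
    ∀ t₁ t₂ : ℝ, 0 < t₁ → t₁ < t₂ → t₂ < T →
    ∫⁻ t in Ioo t₁ t₂,
      ((∫⁻ x in Ω', ENNReal.ofReal |u x t| ∂μ) + totalVariation μ (fun x => u x t) Ω') < ∞

/-! ### The parabolic De Giorgi class -/

/-- The backward cylinder `Q⁻_{r,θ}(y, s) = B_r(y) × (s - θ r, s]`. -/
def backwardCylinder {X : Type*} [MetricSpace X] (y : X) (s r θ : ℝ) : Set (X × ℝ) :=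
  ball y r ×ˢ Ioc (s - θ * r) s

/-- The forward cylinder `Q⁺_{2ρ,θ}(x₀, t₀) = B_{2ρ}(x₀) × (t₀, t₀ + θ ρ)`. -/
def forwardCylinder {X : Type*} [MetricSpace X] (x₀ : X) (t₀ ρ θ : ℝ) : Set (X × ℝ) :=
  ball x₀ (2 * ρ) ×ˢ Ioo t₀ (t₀ + θ * ρ)

/-- The negative part `(a)_- = max (-a) 0`. -/
def negPart (a : ℝ) : ℝ := max (-a) 0

/-- The weighted energy `∫_{B_r(y)} φ(t) (u(t) - k)_-² dμ` at time `t`. -/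
def energy {X : Type*} [MetricSpace X] [MeasurableSpace X] (μ : Measure X) (u φ : X → ℝ → ℝ)
    (k : ℝ) (y : X) (r t : ℝ) : ℝ≥0∞ :=
  ∫⁻ x in ball y r, ENNReal.ofReal (φ x t * negPart (u x t - k) ^ 2) ∂μ

/-- Admissible cut-off functions: `φ ∈ Lip(Ω_T)`, `supp φ ⋐ B_r(y) × (0, T)` and `0 ≤ φ ≤ 1`. -/
structure IsCutoff {X : Type*} [MetricSpace X] (Ω : Set X) (T : ℝ) (y : X) (r : ℝ)
    (φ : X → ℝ → ℝ) : Prop where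
  lipschitz : ∃ C : ℝ≥0, LipschitzOnWith C (fun p : X × ℝ => φ p.1 p.2) (spaceTime Ω T)
  support : CompactlyIn (Function.support fun p : X × ℝ => φ p.1 p.2) (ball y r ×ˢ Ioo 0 T)
  nonneg : ∀ x t, 0 ≤ φ x t
  le_one : ∀ x t, φ x t ≤ 1

/-- The parabolic De Giorgi class `DG⁻(Ω_T; γ)`. The slices `u(·, t)` at single times enter the
inequality, so `u` is a function defined at every time, and the slices have to make the energies
finite. The inequality is stated for every `1`-weak upper gradient `g(·, t)` of `φ(·, t)`; this is
the same as stating it for the minimal one. -/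
structure DGminus {X : Type*} [MetricSpace X] [MeasurableSpace X] (μ : Measure X)
    (Ω : Set X) (T γ : ℝ) (u : X → ℝ → ℝ) : Prop where
  memL1LocBVLoc : MemL1LocBVLoc μ Ω T u
  slice : ∀ t ∈ Ioo 0 T, ∀ (k : ℝ) (Ω' : Set X), IsOpen Ω' → CompactlyIn Ω' Ω →
    MemLp (fun x => negPart (u x t - k)) 2 (μ.restrict Ω')
  ineq : ∀ (y : X) (s r θ : ℝ), 0 < r → 0 < θ →
    CompactlyIn (backwardCylinder y s r θ) (spaceTime Ω T) →
    ∀ (k : ℝ) (φ : X → ℝ → ℝ), IsCutoff Ω T y r φ →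
    ∀ g : X → ℝ → ℝ≥0∞, Measurable (fun p : X × ℝ => g p.1 p.2) →
    (∀ᵐ t ∂(volume.restrict (Ioc (s - θ * r) s)),
      IsWeakUpperGradient μ (ball y r) (fun x => g x t) (fun x => φ x t)) →
    max (essSup (fun t => energy μ u φ k y r t) (volume.restrict (Icc (s - θ * r) s)))
        (energy μ u φ k y r s)
      + ∫⁻ t in Ioc (s - θ * r) s,
          totalVariation μ (fun x => φ x t * negPart (u x t - k)) (ball y r)
    ≤ ENNReal.ofReal γ *
        ((∫⁻ p in backwardCylinder y s r θ,
            ENNReal.ofReal (|deriv (φ p.1) p.2| * negPart (u p.1 p.2 - k) ^ 2) ∂(μ.prod volume))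
          + ∫⁻ p in backwardCylinder y s r θ,
            g p.1 p.2 * ENNReal.ofReal (negPart (u p.1 p.2 - k)) ∂(μ.prod volume))
      + energy μ u φ k y r (s - θ * r)

end MetricTV

end

/-! Put κ = ξω, k = m₋ + κ and w = (u - k)₋, so that 0 ≤ w ≤ κ a.e. in the cylinder, and let K be a
compact subset of {u(t₀) ≥ k} ∩ B_ρ of almost full measure. A cut-off of balls alone leaves an
initial energy of order κ² times the measure of the part of its support where u < k, which need not
be small. The cut-off is therefore adapted to the solution: it lives where w is small at the initial
time, and its gradient is paid for by the total variation of w at that time.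

The slice at t₀ gives no control of the total variation, so the argument starts from a slightly
later time s₀. The energy, up to a linear term, decreases in time, hence is continuous at almost
every time; started from a time of continuity, the De Giorgi inequality bounds the time average of
‖D(ηw)‖ by R ~ γκμ(B_ρ)/ρ, and a good s₀ is found arbitrarily close to t₀
(`DGminus.exists_totalVariation_lt`). Passing from t₀ to s₀ loses little: w vanishes on K at t₀, so
a cut-off of a thin neighbourhood of K has tiny initial energy, and its large gradient is harmless
over a short time (`DGminus.eventually_measure_le`).

At s₀, replace ηw by a locally Lipschitz F close in L¹ with ∫ g_F < 2R, and test with φ = min(ζ, (1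
- F/(lκ))₊). Its gradient has mass at most 2R/(lκ) plus that of ζ, and its initial energy is about
l²κ²μ(B_ρ) up to the doubling constant. For small l, and then t - s₀ ≤ δκρ with small δ, the energy
at t is a small multiple of κ²μ(B_ρ), so w(t) ≤ κ/2 on most of K by Chebyshev's inequality
(`DGminus.measure_le_of_totalVariation_lt`). -/

noncomputable section

namespace MetricTV

/-! ### Doubling: properness of the space and local finiteness of the measure -/

section Doubling

variable {X : Type*} [MetricSpace X] [MeasurableSpace X] {μ : Measure X} {Cμ : ℝ}

theorem IsDoubling.measure_ball_two_pow_le (h : IsDoubling μ Cμ) (x : X) {r : ℝ} (hr : 0 < r)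
    (n : ℕ) : μ (ball x (2 ^ n * r)) ≤ ENNReal.ofReal Cμ ^ n * μ (ball x r) := by
  induction n with
  | zero => simp
  | succ n ih =>
    calc μ (ball x (2 ^ (n + 1) * r)) = μ (ball x (2 * (2 ^ n * r))) := by ring_nf
      _ ≤ ENNReal.ofReal Cμ * μ (ball x (2 ^ n * r)) := (h x _ (by positivity)).2.2
      _ ≤ ENNReal.ofReal Cμ * (ENNReal.ofReal Cμ ^ n * μ (ball x r)) := by gcongr
      _ = _ := by rw [pow_succ]; ring

/-- An infinite `e`-separated sequence in the ball would give infinitely many disjoint balls of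
radius `e / 2`, all of measure bounded below by doubling, inside a ball of finite measure. -/
theorem IsDoubling.totallyBounded_ball [OpensMeasurableSpace X] (h : IsDoubling μ Cμ) (x : X)
    {R : ℝ} (hR : 0 < R) : TotallyBounded (ball x R) := by
  rw [Metric.totallyBounded_iff]
  intro e he
  by_contra! hcon
  obtain ⟨f, hf, hf'⟩ := exists_seq_of_forall_finset_exists (fun y => y ∈ ball x R)
    (fun y z => e ≤ dist z y) (fun s _ => by
      obtain ⟨y, hy, hy'⟩ := Set.not_subset.1 (hcon s s.finite_toSet)
      refine ⟨y, hy, fun z hz => ?_⟩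
      by_contra! hlt
      exact hy' (mem_biUnion (Finset.mem_coe.2 hz) hlt))
  have hsep : ∀ i j, i ≠ j → e ≤ dist (f i) (f j) := by
    intro i j hij
    rcases lt_or_gt_of_ne hij with hlt | hlt
    · rw [dist_comm]; exact hf' i j hlt
    · exact hf' j i hlt
  obtain ⟨n, hn⟩ := pow_unbounded_of_one_lt (2 * R / (e / 2)) (one_lt_two (α := ℝ))
  have hn' : 2 * R ≤ 2 ^ n * (e / 2) := by
    rw [div_lt_iff₀ (by positivity)] at hn; exact hn.le
  have hlow : ∀ i, μ (ball x R) ≤ ENNReal.ofReal Cμ ^ n * μ (ball (f i) (e / 2)) := by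
    intro i
    refine le_trans (measure_mono ?_) (h.measure_ball_two_pow_le (f i) (half_pos he) n)
    intro y hy
    have h1 := mem_ball.1 hy
    have h2 := mem_ball'.1 (hf i)
    have h3 := dist_triangle y x (f i)
    exact mem_ball.2 (by linarith)
  have hpos := (h x R hR).1
  have hfin : (ENNReal.ofReal Cμ ^ n) ≠ ∞ := by finiteness
  have hne : (ENNReal.ofReal Cμ ^ n) ≠ 0 := by
    intro h0
    have := hlow 0
    rw [h0, zero_mul] at this
    exact hpos.ne' (le_antisymm this bot_le)
  have hfinite := Measure.finite_const_le_meas_of_disjoint_iUnion μ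
    (ε := μ (ball x R) / ENNReal.ofReal Cμ ^ n) (ENNReal.div_pos hpos.ne' hfin)
    (As := fun i => ball (f i) (e / 2)) (fun i => measurableSet_ball)
    (fun i j (hij : i ≠ j) => ball_disjoint_ball (by linarith [hsep i j hij]))
    (ne_top_of_le_ne_top (h x (2 * R + e) (by positivity)).2.1.ne
      (measure_mono (iUnion_subset fun i y hy => by
        have h1 := mem_ball.1 hy
        have h2 := mem_ball.1 (hf i)
        have h3 := dist_triangle y (f i) x
        exact mem_ball.2 (by linarith))))
  refine infinite_univ (α := ℕ) (hfinite.subset fun i _ => ?_)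
  exact ENNReal.div_le_of_le_mul' (hlow i)

theorem IsDoubling.properSpace [CompleteSpace X] [OpensMeasurableSpace X] (h : IsDoubling μ Cμ) :
    ProperSpace X := by
  refine ⟨fun x r => ?_⟩
  refine TotallyBounded.isCompact_of_isClosed
    ((h.totallyBounded_ball x (R := |r| + 1) (by positivity)).subset ?_) isClosed_closedBall
  exact closedBall_subset_ball (by linarith [le_abs_self r])

theorem IsDoubling.isLocallyFiniteMeasure (h : IsDoubling μ Cμ) : IsLocallyFiniteMeasure μ :=
  ⟨fun x => ⟨ball x 1, ball_mem_nhds x one_pos, (h x 1 one_pos).2.1⟩⟩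

end Doubling

/-! ### Weak upper gradients and relaxation -/

section UpperGradients

theorem RectCurve.edist_le_len {X : Type*} [MetricSpace X] {U : Set X} (c : RectCurve U) :
    edist (c.toFun 0) (c.toFun c.len) ≤ ENNReal.ofReal c.len := by
  have h0 : (0 : ℝ) ∈ Icc 0 c.len := ⟨le_rfl, c.len_nonneg⟩
  have h1 : c.len ∈ Icc 0 c.len := ⟨c.len_nonneg, le_rfl⟩
  have h := c.unitSpeed h0 h1
  simp only [inter_self, NNReal.coe_one, one_mul, sub_zero] at h
  exact h ▸ eVariationOn.edist_le _ h0 h1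

variable {X : Type*} [MetricSpace X] [MeasurableSpace X] {μ : Measure X} {U : Set X}

theorem modulusOne_mono {Γ₁ Γ₂ : Set (RectCurve U)} (h : Γ₁ ⊆ Γ₂) :
    modulusOne μ Γ₁ ≤ modulusOne μ Γ₂ := by
  unfold modulusOne
  gcongr with f hf
  exact iInf_mono' fun hh => ⟨fun c hc => hh c (h hc), le_rfl⟩

theorem modulusOne_empty : modulusOne μ (∅ : Set (RectCurve U)) = 0 := by
  refine le_antisymm ?_ bot_le
  refine (iInf_le _ (fun _ => 0)).trans ((iInf_le _ measurable_const).trans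
    ((iInf_le _ (by simp)).trans (by simp)))

/-- A function whose increments are dominated by those of `F` and by the distance. -/
theorem IsWeakUpperGradient.of_abs_sub_le {F φ : X → ℝ} {g : X → ℝ≥0∞}
    (hF : IsWeakUpperGradient μ U g F) {a L : ℝ} (ha : 0 ≤ a) (hL : 0 ≤ L)
    (h : ∀ x ∈ U, ∀ y ∈ U, |φ x - φ y| ≤ a * |F x - F y| + L * dist x y) :
    IsWeakUpperGradient μ U (fun x => ENNReal.ofReal a * g x + ENNReal.ofReal L) φ := by
  refine ⟨(hF.1.const_mul _).add_const _, le_antisymm ?_ bot_le⟩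
  -- Every curve that is good for `F` is good for `φ`, because the distance of its endpoints is at
  -- most its length; so the exceptional family only shrinks.
  refine (modulusOne_mono fun c hc => ?_).trans hF.2.le
  simp only [mem_ofPred_eq] at hc ⊢
  contrapose! hc
  have h0 : c.toFun 0 ∈ U := c.mapsTo ⟨le_rfl, c.len_nonneg⟩
  have h1 : c.toFun c.len ∈ U := c.mapsTo ⟨c.len_nonneg, le_rfl⟩
  unfold RectCurve.UpperGradientIneq at hc ⊢
  calc ENNReal.ofReal |φ (c.toFun 0) - φ (c.toFun c.len)|
      ≤ ENNReal.ofReal (a * |F (c.toFun 0) - F (c.toFun c.len)|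
          + L * dist (c.toFun 0) (c.toFun c.len)) := ENNReal.ofReal_le_ofReal (h _ h0 _ h1)
    _ = ENNReal.ofReal a * ENNReal.ofReal |F (c.toFun 0) - F (c.toFun c.len)|
          + ENNReal.ofReal L * edist (c.toFun 0) (c.toFun c.len) := by
        rw [ENNReal.ofReal_add (by positivity) (by positivity), ENNReal.ofReal_mul ha,
          ENNReal.ofReal_mul hL, edist_dist]
    _ ≤ ENNReal.ofReal a * c.lineIntegral g + ENNReal.ofReal L * ENNReal.ofReal c.len := by
        gcongr
        exact c.edist_le_len
    _ ≤ c.lineIntegral (fun x => ENNReal.ofReal a * g x + ENNReal.ofReal L) := by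
        unfold RectCurve.lineIntegral
        rw [lintegral_add_right _ measurable_const, lintegral_const_mul' _ _ ENNReal.ofReal_ne_top]
        simp

theorem isWeakUpperGradient_of_lipschitzWith {φ : X → ℝ} {L : ℝ≥0} (h : LipschitzWith L φ) :
    IsWeakUpperGradient μ U (fun _ => (L : ℝ≥0∞)) φ := by
  have h0 : IsWeakUpperGradient μ U (fun _ => 0) (fun _ : X => (0 : ℝ)) := by
    refine ⟨measurable_const, ?_⟩
    have : {c : RectCurve U | ¬ c.UpperGradientIneq (fun _ => 0) fun _ => 0} = ∅ := by
      ext c; simp [RectCurve.UpperGradientIneq]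
    rw [this, modulusOne_empty]
  have := h0.of_abs_sub_le (φ := φ) (a := 0) (L := L) le_rfl L.coe_nonneg
    (fun x _ y _ => by simpa [Real.dist_eq] using h.dist_le_mul x y)
  simpa using this

/-- Functions of finite total variation are approximated by locally Lipschitz functions with
control on the weak upper gradients. -/
theorem exists_lipLoc_of_totalVariation_lt {f : X → ℝ} {M : ℝ≥0∞}
    (h : totalVariation μ f U < M) {K : Set X} (hK : IsCompact K) (hKU : K ⊆ U) {e : ℝ≥0∞}
    (he : 0 < e) : ∃ (F : X → ℝ) (g : X → ℝ≥0∞), LipLoc U F ∧ IsWeakUpperGradient μ U g F ∧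
      ∫⁻ x in K, ENNReal.ofReal |F x - f x| ∂μ < e ∧ ∫⁻ x in U, g x ∂μ < M := by
  unfold totalVariation at h
  simp only [iInf_lt_iff] at h
  obtain ⟨F, g, hF, hg, hconv, hlt⟩ := h
  obtain ⟨i, hi, hi'⟩ := ((frequently_lt_of_liminf_lt (by isBoundedDefault) hlt).and_eventually
    ((hconv K hKU hK).eventually (gt_mem_nhds he))).exists
  exact ⟨F i, g i, hF i, hg i, hi', hi⟩

end UpperGradients

/-! ### Lipschitz cut-off functions in space -/

section Plateau

variable {X : Type*} [MetricSpace X]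

/-- The cut-off function that is `1` on `K` and decays linearly within distance `e` of `K`. -/
def plateau (K : Set X) (e : ℝ≥0) (x : X) : ℝ := max 0 (1 - (e : ℝ)⁻¹ * infDist x K)

theorem plateau_nonneg (K : Set X) (e : ℝ≥0) (x : X) : 0 ≤ plateau K e x := le_max_left _ _

theorem plateau_le_one (K : Set X) (e : ℝ≥0) (x : X) : plateau K e x ≤ 1 := by
  refine max_le zero_le_one ?_
  have : 0 ≤ (e : ℝ)⁻¹ * infDist x K := mul_nonneg (by positivity) infDist_nonneg
  linarith

theorem plateau_of_mem {K : Set X} (e : ℝ≥0) {x : X} (hx : x ∈ K) : plateau K e x = 1 := by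
  simp [plateau, infDist_zero_of_mem hx]

theorem lipschitzWith_plateau (K : Set X) (e : ℝ≥0) : LipschitzWith e⁻¹ (plateau K e) := by
  refine LipschitzWith.const_max (LipschitzWith.of_dist_le_mul fun x y => ?_) 0
  have h := (lipschitz_infDist_pt K).dist_le_mul x y
  simp only [Real.dist_eq, NNReal.coe_one, one_mul, NNReal.coe_inv] at h ⊢
  rw [show 1 - (e : ℝ)⁻¹ * infDist x K - (1 - (e : ℝ)⁻¹ * infDist y K)
    = (e : ℝ)⁻¹ * (-(infDist x K - infDist y K)) by ring, abs_mul, abs_neg,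
    abs_of_nonneg (by positivity)]
  gcongr

theorem infDist_lt_of_plateau_ne_zero {K : Set X} {e : ℝ≥0} (he : 0 < e) {x : X}
    (hx : plateau K e x ≠ 0) : infDist x K < e := by
  by_contra! h
  refine hx (max_eq_left ?_)
  have he' : (0 : ℝ) < e := he
  have : 1 ≤ (e : ℝ)⁻¹ * infDist x K := by
    rw [inv_mul_eq_div, one_le_div he']; exact h
  linarith

theorem plateau_eq_zero_of_notMem_closedBall {K : Set X} (hK : K.Nonempty) {e : ℝ≥0} (he : 0 < e)
    {x₀ : X} {r : ℝ} (hKr : K ⊆ closedBall x₀ r) {x : X} (hx : x ∉ closedBall x₀ (r + e)) :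
    plateau K e x = 0 := by
  by_contra h
  obtain ⟨y, hy, hxy⟩ := (infDist_lt_iff hK).1 (infDist_lt_of_plateau_ne_zero he h)
  have h1 := mem_closedBall.1 (hKr hy)
  have h2 := dist_triangle x y x₀
  exact hx (mem_closedBall.2 (by linarith))

end Plateau

/-- Lipschitz cut-off functions on `X` with compact support in the ball `B_r(y)`. -/
structure IsSpatialCutoff {X : Type*} [MetricSpace X] (y : X) (r : ℝ) (φ : X → ℝ) : Prop where
  lipschitz : ∃ C : ℝ≥0, LipschitzWith C φ
  support : ∃ K, IsCompact K ∧ K ⊆ ball y r ∧ ∀ x ∉ K, φ x = 0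
  nonneg : ∀ x, 0 ≤ φ x
  le_one : ∀ x, φ x ≤ 1

theorem isSpatialCutoff_plateau {X : Type*} [MetricSpace X] [ProperSpace X] {y : X} {r ρ : ℝ}
    {K : Set X} (hK : K.Nonempty) (hKρ : K ⊆ closedBall y ρ) {e : ℝ≥0} (he : 0 < e)
    (hr : ρ + e < r) : IsSpatialCutoff y r (plateau K e) :=
  ⟨⟨_, lipschitzWith_plateau K e⟩,
    ⟨closedBall y (ρ + e), isCompact_closedBall _ _, closedBall_subset_ball hr,
      fun _ hx => plateau_eq_zero_of_notMem_closedBall hK he hKρ hx⟩,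
    plateau_nonneg K e, plateau_le_one K e⟩

/-! ### The De Giorgi inequality without the time derivative -/

section Stationary

variable {X : Type*} [MetricSpace X] [MeasurableSpace X] [BorelSpace X] {μ : Measure X} {Ω : Set X} {T γ : ℝ}
  {u : X → ℝ → ℝ} {y : X} {r : ℝ}

theorem negPart_nonneg (a : ℝ) : 0 ≤ negPart a := le_max_right _ _

/-- The De Giorgi inequality for cut-off functions that do not depend on time. -/
theorem DGminus.ineq_stationary [ProperSpace X] (hu : DGminus μ Ω T γ u) (hr : 0 < r)
    (hU : closedBall y r ⊆ Ω) {s₀ s : ℝ} (hs₀ : 0 < s₀) (hs : s₀ < s) (hsT : s < T) (k : ℝ)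
    {φ : X → ℝ} (hφ : IsSpatialCutoff y r φ) {g : X → ℝ≥0∞} (hg : IsWeakUpperGradient μ (ball y r) g φ) :
    max (essSup (fun t => energy μ u (fun x _ => φ x) k y r t) (volume.restrict (Icc s₀ s)))
        (energy μ u (fun x _ => φ x) k y r s)
      + ∫⁻ t in Ioc s₀ s, totalVariation μ (fun x => φ x * negPart (u x t - k)) (ball y r)
    ≤ ENNReal.ofReal γ * (∫⁻ p in ball y r ×ˢ Ioc s₀ s,
          g p.1 * ENNReal.ofReal (negPart (u p.1 p.2 - k)) ∂(μ.prod volume))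
      + energy μ u (fun x _ => φ x) k y r s₀ := by
  obtain ⟨⟨C, hφ⟩, ⟨K, hK, hKU, hsupp⟩, hφ0, hφ1⟩ := hφ
  obtain ⟨e, he, he₀, heT⟩ : ∃ e : ℝ, 0 < e ∧ 2 * e < s₀ ∧ s + 2 * e < T :=
    ⟨min s₀ (T - s) / 3, by have := lt_min hs₀ (sub_pos.2 hsT); positivity,
      by have := min_le_left s₀ (T - s); linarith, by have := min_le_right s₀ (T - s); linarith⟩
  -- A trapezoid in time, at least 1 on [s₀ - e, s + e] and zero outside [s₀ - 2e, s + 2e]. Since φ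
  -- ≤ 1, the minimum with it equals φ near every time of [s₀, s], endpoints included, so the time
  -- derivative vanishes on the cylinder.
  set ψ : ℝ → ℝ := fun t => max 0 (2 - (|t - (s₀ + s) / 2| - (s - s₀) / 2) / e) with hψ
  set Φ : X → ℝ → ℝ := fun x t => min (φ x) (ψ t) with hΦ
  have hψ1 : ∀ t ∈ Icc (s₀ - e) (s + e), 1 ≤ ψ t := by
    intro t ht
    refine le_max_of_le_right ?_
    have : |t - (s₀ + s) / 2| ≤ (s - s₀) / 2 + e := abs_le.2 ⟨by linarith [ht.1], by linarith [ht.2]⟩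
    have : (|t - (s₀ + s) / 2| - (s - s₀) / 2) / e ≤ 1 := by
      rw [div_le_one he]; linarith
    linarith
  have hΦeq : ∀ t ∈ Icc (s₀ - e) (s + e), ∀ x, Φ x t = φ x := fun t ht x =>
    min_eq_left ((hφ1 x).trans (hψ1 t ht))
  have hψ0 : ∀ t ∉ Icc (s₀ - 2 * e) (s + 2 * e), ψ t = 0 := by
    intro t ht
    refine max_eq_left ?_
    have : (s - s₀) / 2 + 2 * e ≤ |t - (s₀ + s) / 2| := by
      by_contra! hlt
      have := abs_lt.1 hlt
      exact ht ⟨by linarith [this.1], by linarith [this.2]⟩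
    have : 2 ≤ (|t - (s₀ + s) / 2| - (s - s₀) / 2) / e := by
      rw [le_div_iff₀ he]; linarith
    linarith
  have hψL : LipschitzWith (Real.toNNReal e⁻¹) ψ := by
    refine LipschitzWith.const_max (LipschitzWith.of_dist_le_mul fun a b => ?_) 0
    rw [Real.coe_toNNReal _ (by positivity), Real.dist_eq, Real.dist_eq,
      show 2 - (|a - (s₀ + s) / 2| - (s - s₀) / 2) / e
        - (2 - (|b - (s₀ + s) / 2| - (s - s₀) / 2) / e)
        = e⁻¹ * (|b - (s₀ + s) / 2| - |a - (s₀ + s) / 2|) by field_simp; ring, abs_mul,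
      abs_of_pos (inv_pos.2 he)]
    refine mul_le_mul_of_nonneg_left ((abs_abs_sub_abs_le _ _).trans_eq ?_) (inv_pos.2 he).le
    rw [abs_sub_comm]; congr 1; ring
  have hcut : IsCutoff Ω T y r Φ := by
    refine ⟨⟨max C (Real.toNNReal e⁻¹), LipschitzWith.lipschitzOnWith ?_⟩, ?_, fun x t => ?_,
      fun x t => ?_⟩
    · have h1 := hφ.comp (LipschitzWith.prod_fst (α := X) (β := ℝ))
      have h2 := hψL.comp (LipschitzWith.prod_snd (α := X) (β := ℝ))
      simpa using h1.min h2
    · have hcomp : IsCompact (K ×ˢ Icc (s₀ - 2 * e) (s + 2 * e)) := hK.prod isCompact_Icc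
      have hsub : (Function.support fun p : X × ℝ => Φ p.1 p.2)
          ⊆ K ×ˢ Icc (s₀ - 2 * e) (s + 2 * e) := by
        intro p hp
        by_contra hn
        refine hp ?_
        rw [mem_prod, not_and_or] at hn
        rcases hn with hn | hn
        · simp only [hΦ, hsupp _ hn]
          exact min_eq_left (le_max_left _ _)
        · simp only [hΦ, hψ0 _ hn]
          exact min_eq_right (hφ0 _)
      have hcl := closure_minimal hsub hcomp.isClosed
      refine ⟨hcomp.of_isClosed_subset isClosed_closure hcl, hcl.trans (prod_mono hKU ?_)⟩
      exact fun t ht => ⟨by linarith [ht.1], by linarith [ht.2]⟩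
    · exact le_min (hφ0 x) (le_max_left _ _)
    · exact (min_le_left _ _).trans (hφ1 x)
  have hθ : s - (s - s₀) / r * r = s₀ := by field_simp; ring
  have hQ : CompactlyIn (backwardCylinder y s r ((s - s₀) / r)) (spaceTime Ω T) := by
    have hcomp : IsCompact (closedBall y r ×ˢ Icc s₀ s) :=
      (isCompact_closedBall y r).prod isCompact_Icc
    have hcl : closure (backwardCylinder y s r ((s - s₀) / r)) ⊆ closedBall y r ×ˢ Icc s₀ s := by
      refine closure_minimal ?_ hcomp.isClosed
      rw [backwardCylinder, hθ]
      exact prod_mono ball_subset_closedBall Ioc_subset_Icc_self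
    exact ⟨hcomp.of_isClosed_subset isClosed_closure hcl, hcl.trans
      (prod_mono hU fun t (ht : t ∈ Icc s₀ s) => ⟨by linarith [ht.1], by linarith [ht.2]⟩)⟩
  have hIcc : ∀ t ∈ Icc s₀ s, t ∈ Icc (s₀ - e) (s + e) := fun t ht =>
    ⟨by linarith [ht.1], by linarith [ht.2]⟩
  have hE : ∀ t ∈ Icc s₀ s, energy μ u Φ k y r t = energy μ u (fun x _ => φ x) k y r t := by
    intro t ht
    simp only [energy, hΦeq t (hIcc t ht)]
  have key := hu.ineq y s r ((s - s₀) / r) hr (div_pos (sub_pos.2 hs) hr) hQ k Φ hcut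
    (fun x _ => g x) (hg.1.comp measurable_fst) (by
      rw [hθ]
      refine (ae_restrict_mem measurableSet_Ioc).mono fun t ht => ?_
      simp only [hΦeq t (hIcc t (Ioc_subset_Icc_self ht))]
      exact hg)
  rw [hθ, hE s ⟨hs.le, le_rfl⟩, hE s₀ ⟨le_rfl, hs.le⟩, backwardCylinder, hθ,
    essSup_congr_ae ((ae_restrict_mem measurableSet_Icc).mono fun t ht => hE t ht),
    setLIntegral_congr_fun (g := fun t => totalVariation μ (fun x => φ x * negPart (u x t - k))
      (ball y r)) measurableSet_Ioc (fun t ht => by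
        simp only [hΦeq t (hIcc t (Ioc_subset_Icc_self ht))])] at key
  refine key.trans ?_
  gcongr
  have h0 : ∫⁻ p in ball y r ×ˢ Ioc s₀ s, ENNReal.ofReal
      (|deriv (Φ p.1) p.2| * negPart (u p.1 p.2 - k) ^ 2) ∂(μ.prod volume) = 0 := by
    rw [setLIntegral_congr_fun (g := fun _ => 0) (measurableSet_ball.prod measurableSet_Ioc)
      (fun p hp => ?_), lintegral_zero]
    have hev : Φ p.1 =ᶠ[𝓝 p.2] fun _ => φ p.1 := by
      filter_upwards [Icc_mem_nhds (show s₀ - e < p.2 by linarith [hp.2.1])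
        (show p.2 < s + e by linarith [hp.2.2])] with t ht using hΦeq t ht p.1
    simp [hev.deriv_eq]
  rw [h0, zero_add]

end Stationary

theorem compactlyIn_ball {X : Type*} [MetricSpace X] [ProperSpace X] {Ω : Set X} {y : X} {r : ℝ}
    (hU : closedBall y r ⊆ Ω) : CompactlyIn (ball y r) Ω :=
  ⟨(isCompact_closedBall y r).of_isClosed_subset isClosed_closure closure_ball_subset_closedBall,
    closure_ball_subset_closedBall.trans hU⟩

/-! ### Consequences for bounded truncations: a good time and the passage from `t₀` -/

section Bounded

variable {X : Type*} [MetricSpace X] [ProperSpace X] [MeasurableSpace X] {μ : Measure X} {Ω : Set X} {T γ : ℝ} {u : X → ℝ → ℝ} {y : X} {r : ℝ}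

theorem DGminus.aemeasurable_slice (hu : DGminus μ Ω T γ u) (hU : closedBall y r ⊆ Ω) {t : ℝ}
    (ht : t ∈ Ioo 0 T) (k : ℝ) :
    AEMeasurable (fun x => negPart (u x t - k)) (μ.restrict (ball y r)) :=
  (hu.slice t ht k _ isOpen_ball (compactlyIn_ball hU)).1.aemeasurable

theorem DGminus.lintegral_sq_slice_lt_top (hu : DGminus μ Ω T γ u) (hU : closedBall y r ⊆ Ω)
    {t : ℝ} (ht : t ∈ Ioo 0 T) (k : ℝ) :
    ∫⁻ x in ball y r, ENNReal.ofReal (negPart (u x t - k) ^ 2) ∂μ < ∞ := by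
  have h := (hu.slice t ht k _ isOpen_ball (compactlyIn_ball hU)).integrable_sq
  exact h.lintegral_lt_top

theorem DGminus.energy_lt_top (hu : DGminus μ Ω T γ u) (hU : closedBall y r ⊆ Ω)
    {t : ℝ} (ht : t ∈ Ioo 0 T) (k : ℝ) {φ : X → ℝ} (hφ : IsSpatialCutoff y r φ) :
    energy μ u (fun x _ => φ x) k y r t < ∞ := by
  refine lt_of_le_of_lt (lintegral_mono fun x => ENNReal.ofReal_le_ofReal ?_)
    (hu.lintegral_sq_slice_lt_top hU ht k)
  exact mul_le_of_le_one_left (sq_nonneg _) (hφ.le_one x)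

variable [BorelSpace X] [IsLocallyFiniteMeasure μ]

/-- The De Giorgi inequality for time-independent cut-off functions and bounded `(u - k)_-`. -/
theorem DGminus.ineq_of_bound (hu : DGminus μ Ω T γ u) (hr : 0 < r) (hU : closedBall y r ⊆ Ω)
    {t₀ t₁ : ℝ} (ht₀ : 0 < t₀) (ht₁ : t₁ ≤ T) {k κ : ℝ}
    (hb : ∀ᵐ p ∂((μ.prod volume).restrict (ball y r ×ˢ Ioo t₀ t₁)),
      negPart (u p.1 p.2 - k) ≤ κ)
    {φ : X → ℝ} (hφ : IsSpatialCutoff y r φ) {g : X → ℝ≥0∞}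
    (hg : IsWeakUpperGradient μ (ball y r) g φ) {s₀ s : ℝ} (hs₀ : t₀ ≤ s₀) (hs : s₀ < s)
    (hs₁ : s < t₁) :
    max (essSup (fun t => energy μ u (fun x _ => φ x) k y r t) (volume.restrict (Icc s₀ s)))
        (energy μ u (fun x _ => φ x) k y r s)
      + ∫⁻ t in Ioc s₀ s, totalVariation μ (fun x => φ x * negPart (u x t - k)) (ball y r)
    ≤ ENNReal.ofReal γ * ENNReal.ofReal κ * (∫⁻ x in ball y r, g x ∂μ) * ENNReal.ofReal (s - s₀)
      + energy μ u (fun x _ => φ x) k y r s₀ := by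
  refine (hu.ineq_stationary hr hU (ht₀.trans_le hs₀) hs (hs₁.trans_le ht₁) k hφ hg).trans ?_
  refine add_le_add ?_ le_rfl
  rw [mul_assoc (ENNReal.ofReal γ * _), mul_assoc (ENNReal.ofReal γ)]
  refine mul_le_mul' le_rfl ?_
  have hsub : ball y r ×ˢ Ioc s₀ s ⊆ ball y r ×ˢ Ioo t₀ t₁ :=
    prod_mono le_rfl fun t ht => ⟨hs₀.trans_lt ht.1, ht.2.trans_lt hs₁⟩
  calc ∫⁻ p in ball y r ×ˢ Ioc s₀ s, g p.1 * ENNReal.ofReal (negPart (u p.1 p.2 - k))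
        ∂(μ.prod volume)
      ≤ ∫⁻ p in ball y r ×ˢ Ioc s₀ s, g p.1 * ENNReal.ofReal κ ∂(μ.prod volume) := by
        refine lintegral_mono_ae ((ae_restrict_of_ae_restrict_of_subset hsub hb).mono
          fun p hp => ?_)
        gcongr
    _ = ENNReal.ofReal κ * ((∫⁻ x in ball y r, g x ∂μ) * ENNReal.ofReal (s - s₀)) := by
        rw [← Measure.prod_restrict,
          lintegral_prod_mul (f := g) (g := fun _ => ENNReal.ofReal κ) hg.1.aemeasurable
            aemeasurable_const]
        simp only [lintegral_const, MeasurableSet.univ, Measure.restrict_apply, univ_inter,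
          Real.volume_Ioc]
        ring

/-- At suitable times arbitrarily close to `t₀` the total variation of the truncation is
controlled by the gradient of the cut-off function. -/
theorem DGminus.exists_totalVariation_lt (hu : DGminus μ Ω T γ u) (hr : 0 < r)
    (hU : closedBall y r ⊆ Ω) {t₀ t₁ : ℝ} (ht₀ : 0 < t₀) (ht₁ : t₁ ≤ T) {k κ : ℝ}
    (hb : ∀ᵐ p ∂((μ.prod volume).restrict (ball y r ×ˢ Ioo t₀ t₁)),
      negPart (u p.1 p.2 - k) ≤ κ)
    {φ : X → ℝ} (hφ : IsSpatialCutoff y r φ) {g : X → ℝ≥0∞}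
    (hg : IsWeakUpperGradient μ (ball y r) g φ) {R : ℝ≥0∞}
    (hR : ENNReal.ofReal γ * ENNReal.ofReal κ * (∫⁻ x in ball y r, g x ∂μ) ≤ R) (hR0 : 0 < R)
    (hRtop : R < ∞) {P : ℝ → Prop} (hP : ∀ᵐ t ∂(volume.restrict (Ioo t₀ t₁)), P t) {τ : ℝ}
    (hτ : τ ∈ Ioo t₀ t₁) :
    ∃ t ∈ Ioo t₀ τ, P t ∧
      totalVariation μ (fun x => φ x * negPart (u x t - k)) (ball y r) < 2 * R := by
  set h : ℝ → ℝ≥0∞ := fun t => energy μ u (fun x _ => φ x) k y r t with hh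
  have hmain : ∀ s₀ s : ℝ, t₀ ≤ s₀ → s₀ < s → s < t₁ →
      max (essSup h (volume.restrict (Icc s₀ s))) (h s) + ∫⁻ t in Ioc s₀ s,
        totalVariation μ (fun x => φ x * negPart (u x t - k)) (ball y r)
      ≤ R * ENNReal.ofReal (s - s₀) + h s₀ := fun s₀ s h1 h2 h3 =>
    (hu.ineq_of_bound hr hU ht₀ ht₁ hb hφ hg h1 h2 h3).trans (by gcongr)
  have hfin : ∀ t ∈ Ioo t₀ τ, h t ≠ ∞ := fun t ht =>
    (hu.energy_lt_top hU ⟨ht₀.trans ht.1, ht.2.trans (hτ.2.trans_le ht₁)⟩ k hφ).ne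
  -- The term `energy … s` in the maximum makes the inequality available between any two times, not
  -- just almost all.
  have hanti : AntitoneOn (fun t => (h t).toReal - R.toReal * t) (Ioo t₀ τ) := by
    intro a ha b hb' hab
    rcases hab.eq_or_lt with rfl | hab
    · exact le_rfl
    have h1 : h b ≤ R * ENNReal.ofReal (b - a) + h a :=
      (le_add_right (le_max_right _ _)).trans (hmain a b ha.1.le hab (hb'.2.trans hτ.2))
    have h2 := ENNReal.toReal_mono (by finiteness [hfin a ha]) h1
    rw [ENNReal.toReal_add (by finiteness) (hfin a ha), ENNReal.toReal_mul,
      ENNReal.toReal_ofReal (sub_pos.2 hab).le] at h2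
    simp only
    linarith
  -- A monotone function has only countably many discontinuities, and the interval is uncountable.
  obtain ⟨s₀, hs₀, hcont⟩ : ∃ s₀ ∈ Ioo t₀ τ,
      ContinuousWithinAt (fun t => (h t).toReal - R.toReal * t) (Ioo t₀ τ) s₀ := by
    by_contra! hcon
    have hc := hanti.countable_not_continuousWithinAt
    have hsub : Ioo t₀ τ ⊆ {x ∈ Ioo t₀ τ | ¬ContinuousWithinAt
        (fun t => (h t).toReal - R.toReal * t) (Ioo t₀ τ) x} := fun x hx => ⟨hx, hcon x hx⟩
    have := (hc.mono hsub).measure_zero volume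
    rw [Real.volume_Ioo, ENNReal.ofReal_eq_zero] at this
    linarith [hτ.1]
  have hcont' : ContinuousAt (fun t => (h t).toReal) s₀ := by
    have h1 := hcont.continuousAt (Ioo_mem_nhds hs₀.1 hs₀.2)
    have h2 : (fun t => (h t).toReal) = fun t => (h t).toReal - R.toReal * t + R.toReal * t := by
      funext t; ring
    rw [h2]
    exact h1.add (by fun_prop)
  obtain ⟨s, hs, hsτ⟩ := exists_between hs₀.2
  -- By continuity `h` exceeds any `c < h s₀` on an interval of positive length to the right of
  -- `s₀`. This lets the energies on both sides cancel, leaving only the total variation.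
  have hle : h s₀ ≤ essSup h (volume.restrict (Icc s₀ s)) := by
    refine le_of_forall_lt fun c hc => ?_
    have hev : ∀ᶠ t in 𝓝 s₀, c < h t := by
      have hc' : c.toReal < (h s₀).toReal := (ENNReal.toReal_lt_toReal hc.ne_top (hfin _ hs₀)).2 hc
      filter_upwards [hcont'.eventually (lt_mem_nhds hc')] with t ht
      by_contra! hle
      exact absurd ht (not_lt.2 (ENNReal.toReal_mono hc.ne_top hle))
    obtain ⟨l, hl, hl'⟩ := (mem_nhdsGE_iff_exists_Ico_subset (a := s₀)).1
      (mem_nhdsWithin_of_mem_nhds hev)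
    have hm : s₀ < min l s := lt_min hl hs
    have hae := ENNReal.ae_le_essSup h (μ := volume.restrict (Icc s₀ s))
    have hpos : (volume.restrict (Icc s₀ s)) (Ioo s₀ (min l s)) ≠ 0 := by
      rw [Measure.restrict_apply measurableSet_Ioo, inter_eq_left.2
        (Ioo_subset_Icc_self.trans (Icc_subset_Icc_right (min_le_right _ _))), Real.volume_Ioo]
      simpa using hm
    obtain ⟨t, ht, ht'⟩ := ((frequently_ae_mem_iff.2 hpos).and_eventually hae).exists
    exact lt_of_lt_of_le (hl' ⟨ht.1.le, ht.2.trans_le (min_le_left _ _)⟩) ht'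
  have hTV : ∫⁻ t in Ioc s₀ s, totalVariation μ (fun x => φ x * negPart (u x t - k)) (ball y r)
      ≤ R * ENNReal.ofReal (s - s₀) := by
    have h1 := hmain s₀ s hs₀.1.le hs (hsτ.trans hτ.2)
    have h2 : h s₀ + ∫⁻ t in Ioc s₀ s, totalVariation μ (fun x => φ x * negPart (u x t - k))
        (ball y r) ≤ h s₀ + R * ENNReal.ofReal (s - s₀) := by
      rw [add_comm (h s₀) (R * _)]
      exact le_trans (by gcongr; exact hle.trans (le_max_left _ _)) h1
    exact (ENNReal.add_le_add_iff_left (hfin _ hs₀)).1 h2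
  -- Otherwise the total variation is at least `2 * R` a.e. on (s₀, s], while its integral is at
  -- most `R * (s - s₀)`.
  by_contra! hcon
  have hlow : ∀ᵐ t ∂(volume.restrict (Ioc s₀ s)),
      2 * R ≤ totalVariation μ (fun x => φ x * negPart (u x t - k)) (ball y r) := by
    have hsub : Ioc s₀ s ⊆ Ioo t₀ t₁ := fun t ht =>
      ⟨hs₀.1.trans ht.1, ht.2.trans_lt (hsτ.trans hτ.2)⟩
    filter_upwards [ae_restrict_of_ae_restrict_of_subset hsub hP,
      ae_restrict_mem measurableSet_Ioc] with t ht ht'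
    exact hcon t ⟨hs₀.1.trans ht'.1, ht'.2.trans_lt hsτ⟩ ht
  have h3 := (lintegral_mono_ae hlow).trans hTV
  rw [lintegral_const, Measure.restrict_apply_univ, Real.volume_Ioc, mul_assoc, two_mul] at h3
  have hpos : 0 < R * ENNReal.ofReal (s - s₀) :=
    ENNReal.mul_pos hR0.ne' (by simpa using hs)
  have hlt := ENNReal.lt_add_right (a := R * ENNReal.ofReal (s - s₀)) (by finiteness) hpos.ne'
  exact absurd h3 (not_le.2 hlt)

/-- Where `u(t₀) ≥ k`, the truncation `(u - k)_-` stays small in measure for a short time. -/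
theorem DGminus.eventually_measure_le (hu : DGminus μ Ω T γ u) (hr : 0 < r)
    (hU : closedBall y r ⊆ Ω) {t₀ t₁ : ℝ} (ht₀ : 0 < t₀) (ht₁ : t₁ ≤ T) (ht : t₀ < t₁) {k κ : ℝ}
    (hb : ∀ᵐ p ∂((μ.prod volume).restrict (ball y r ×ˢ Ioo t₀ t₁)),
      negPart (u p.1 p.2 - k) ≤ κ)
    {K : Set X} (hK : IsCompact K) (hKne : K.Nonempty) {ρ : ℝ} (hρ : ρ < r)
    (hKρ : K ⊆ closedBall y ρ) (hK0 : ∀ x ∈ K, negPart (u x t₀ - k) = 0) {a : ℝ} (ha : 0 < a)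
    {e : ℝ≥0∞} (he : 0 < e) :
    ∀ᶠ t in 𝓝[>] t₀, μ (K ∩ {x | a ≤ negPart (u x t - k)}) ≤ e := by
  have hKU : K ⊆ ball y r := hKρ.trans (closedBall_subset_ball hρ)
  have ha2 : 0 < ENNReal.ofReal (a ^ 2) := ENNReal.ofReal_pos.2 (by positivity)
  rcases eq_or_ne e ∞ with rfl | hetop
  · exact Eventually.of_forall fun _ => le_top
  have he2 : 0 < ENNReal.ofReal (a ^ 2) * e / 2 := by
    simp only [ENNReal.div_pos_iff, ne_eq, mul_eq_zero, not_or]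
    exact ⟨⟨ha2.ne', he.ne'⟩, by simp⟩
  obtain ⟨d, hd, hdr, hdE⟩ : ∃ d : ℝ≥0, 0 < d ∧ ρ + d < r ∧
      energy μ u (fun x _ => plateau K d x) k y r t₀ < ENNReal.ofReal (a ^ 2) * e / 2 := by
    -- The measure w(t₀)² dμ is finite and vanishes on `K`, so the closed thickenings of `K` have
    -- `ν`-measure tending to 0. The compactness of `K` is used here: it is closed.
    set ν : Measure X := (μ.restrict (ball y r)).withDensity
      (fun x => ENNReal.ofReal (negPart (u x t₀ - k) ^ 2)) with hν
    have hνfin : ∀ s, ν s ≠ ∞ := by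
      intro s
      refine ne_top_of_le_ne_top ?_ (measure_mono (subset_univ s))
      rw [hν, withDensity_apply _ MeasurableSet.univ, Measure.restrict_univ]
      exact (hu.lintegral_sq_slice_lt_top hU ⟨ht₀, ht.trans_le ht₁⟩ k).ne
    have hνK : ν K = 0 := by
      rw [hν, withDensity_apply _ hK.measurableSet, setLIntegral_congr_fun (g := fun _ => 0)
        hK.measurableSet (fun x hx => by simp [hK0 x hx])]
      simp
    have htend := tendsto_measure_cthickening_of_isClosed (μ := ν) (s := K)
      ⟨1, one_pos, hνfin _⟩ hK.isClosed
    rw [hνK] at htend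
    have hev : ∀ᶠ d in 𝓝[>] (0 : ℝ), ν (cthickening d K) < ENNReal.ofReal (a ^ 2) * e / 2 :=
      (htend.mono_left nhdsWithin_le_nhds).eventually (gt_mem_nhds he2)
    have hev2 : ∀ᶠ d in 𝓝[>] (0 : ℝ), d < r - ρ :=
      mem_nhdsWithin_of_mem_nhds (gt_mem_nhds (sub_pos.2 hρ))
    obtain ⟨d, ⟨hd1, hd2⟩, hd3⟩ := ((hev.and hev2).and self_mem_nhdsWithin).exists
    refine ⟨⟨d, (mem_Ioi.1 hd3).le⟩, hd3, show ρ + d < r by linarith, lt_of_le_of_lt ?_ hd1⟩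
    rw [hν, withDensity_apply _ isClosed_cthickening.measurableSet,
      ← lintegral_indicator isClosed_cthickening.measurableSet]
    refine lintegral_mono fun x => ?_
    by_cases hx : x ∈ cthickening d K
    · rw [indicator_of_mem hx]
      exact ENNReal.ofReal_le_ofReal (mul_le_of_le_one_left (sq_nonneg _) (plateau_le_one _ _ _))
    · have : plateau K ⟨d, (mem_Ioi.1 hd3).le⟩ x = 0 := by
        by_contra hne
        have hlt := infDist_lt_of_plateau_ne_zero (e := ⟨d, (mem_Ioi.1 hd3).le⟩) hd3 hne
        exact hx (thickening_subset_cthickening _ _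
          ((mem_thickening_iff_infDist_lt hKne).2 hlt))
      simp [this]
  have hcut := isSpatialCutoff_plateau hKne hKρ hd hdr
  set R : ℝ≥0∞ := ENNReal.ofReal γ * ENNReal.ofReal κ * ∫⁻ _ in ball y r, (d⁻¹ : ℝ≥0) ∂μ with hRdef
  have hR : R ≠ ∞ := by
    rw [hRdef, lintegral_const, Measure.restrict_apply_univ]
    have := (measure_ball_lt_top (μ := μ) (x := y) (r := r)).ne
    finiteness
  -- The gradient bound `d⁻¹` may be huge, but `d` is fixed before `t` tends to `t₀`.
  have hsmall : ∀ᶠ t in 𝓝[>] t₀, R * ENNReal.ofReal (t - t₀) < ENNReal.ofReal (a ^ 2) * e / 2 := by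
    have hcont : Tendsto (fun t => R * ENNReal.ofReal (t - t₀)) (𝓝 t₀) (𝓝 0) := by
      have h1 : Tendsto (fun t : ℝ => ENNReal.ofReal (t - t₀)) (𝓝 t₀) (𝓝 0) := by
        have : Continuous fun t : ℝ => ENNReal.ofReal (t - t₀) := ENNReal.continuous_ofReal.comp (by fun_prop)
        simpa using this.tendsto t₀
      simpa using ENNReal.Tendsto.const_mul h1 (Or.inr hR)
    exact mem_nhdsWithin_of_mem_nhds (hcont.eventually (gt_mem_nhds he2))
  filter_upwards [hsmall, Ioo_mem_nhdsGT ht] with t htR htt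
  have hE : energy μ u (fun x _ => plateau K d x) k y r t ≤ ENNReal.ofReal (a ^ 2) * e := by
    have h1 := (le_add_right (le_max_right _ _)).trans (hu.ineq_of_bound hr hU ht₀ ht₁ hb hcut
      (isWeakUpperGradient_of_lipschitzWith (lipschitzWith_plateau K d)) le_rfl htt.1 htt.2)
    refine h1.trans ((add_le_add htR.le hdE.le).trans_eq (ENNReal.add_halves _))
  have hcheb : ENNReal.ofReal (a ^ 2) * μ (K ∩ {x | a ≤ negPart (u x t - k)})
      ≤ energy μ u (fun x _ => plateau K d x) k y r t := by
    have hmeas := hu.aemeasurable_slice hU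
      (show t ∈ Ioo 0 T from ⟨ht₀.trans htt.1, htt.2.trans_le ht₁⟩) k
    have hpl : AEMeasurable (plateau K d) (μ.restrict (ball y r)) :=
      (lipschitzWith_plateau K d).continuous.measurable.aemeasurable
    refine le_trans ?_ (mul_meas_ge_le_lintegral₀
      ((hpl.mul (hmeas.pow_const 2)).ennreal_ofReal) (ENNReal.ofReal (a ^ 2)))
    refine mul_le_mul' le_rfl ?_
    refine le_trans (measure_mono (t := _ ∩ ball y r) ?_) (Measure.le_restrict_apply (ball y r) _)
    rintro x ⟨hxK, hx⟩
    refine ⟨ENNReal.ofReal_le_ofReal ?_, hKU hxK⟩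
    rw [Pi.mul_apply, plateau_of_mem d hxK, one_mul]
    exact pow_le_pow_left₀ ha.le hx 2
  exact (ENNReal.mul_le_mul_iff_right ha2.ne' ENNReal.ofReal_ne_top).1 (hcheb.trans hE)

end Bounded

/-! ### The cut-off adapted to the solution -/

section Truncation

variable {X : Type*} [MetricSpace X] {y : X} {r : ℝ} {ζ F : X → ℝ}

/-- Cutting `ζ` off where the locally Lipschitz function `F` is large. -/
theorem IsSpatialCutoff.min_one_sub (hζ : IsSpatialCutoff y r ζ) (hF : LipLoc (ball y r) F)
    (a : ℝ) : IsSpatialCutoff y r (fun x => min (ζ x) (max 0 (1 - a * F x))) := by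
  obtain ⟨⟨C, hC⟩, ⟨K, hK, hKU, hsupp⟩, h0, h1⟩ := hζ
  refine ⟨?_, ⟨K, hK, hKU, fun x hx => ?_⟩, fun x => le_min (h0 x) (le_max_left _ _),
    fun x => (min_le_left _ _).trans (h1 x)⟩
  · obtain ⟨L, hL⟩ := hF K hKU hK
    -- `F` is Lipschitz only on compact subsets of the ball. Since ζ vanishes off `K`, a global
    -- Lipschitz extension of `F` from `K` gives the same minimum.
    obtain ⟨G, hG, hFG⟩ := hL.extend_real
    have heq : (fun x => min (ζ x) (max 0 (1 - a * F x)))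
        = fun x => min (ζ x) (max 0 (1 - a * G x)) := by
      funext x
      by_cases hx : x ∈ K
      · rw [hFG hx]
      · rw [hsupp x hx, min_eq_left (le_max_left _ _), min_eq_left (le_max_left _ _)]
    rw [heq]
    refine ⟨max C (Real.toNNReal |a| * L), hC.min (LipschitzWith.const_max ?_ 0)⟩
    refine LipschitzWith.of_dist_le_mul fun x z => ?_
    have h := hG.dist_le_mul x z
    rw [Real.dist_eq] at h ⊢
    rw [show 1 - a * G x - (1 - a * G z) = -a * (G x - G z) by ring, abs_mul, abs_neg,
      NNReal.coe_mul, Real.coe_toNNReal _ (abs_nonneg a), mul_assoc]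
    gcongr
  · rw [hsupp x hx]
    exact min_eq_left (le_max_left _ _)

theorem abs_min_one_sub_sub_le {L : ℝ≥0} (hζ : LipschitzWith L ζ) {a : ℝ} (ha : 0 ≤ a) (x z : X) :
    |min (ζ x) (max 0 (1 - a * F x)) - min (ζ z) (max 0 (1 - a * F z))|
      ≤ a * |F x - F z| + L * dist x z := by
  have h1 : |ζ x - ζ z| ≤ L * dist x z := by simpa [Real.dist_eq] using hζ.dist_le_mul x z
  have h2 : |max 0 (1 - a * F x) - max 0 (1 - a * F z)| ≤ a * |F x - F z| := by
    refine (abs_max_sub_max_le_max _ _ _ _).trans ?_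
    rw [show 1 - a * F x - (1 - a * F z) = -(a * (F x - F z)) by ring, abs_neg, abs_mul,
      abs_of_nonneg ha, sub_self, abs_zero]
    exact max_le (by positivity) le_rfl
  have h3 : 0 ≤ a * |F x - F z| := by positivity
  have h4 : 0 ≤ L * dist x z := by positivity
  exact (abs_min_sub_min_le_max _ _ _ _).trans (max_le (by linarith) (by linarith))

/-- Pointwise bound of the initial energy, `f` approximating `w`. Where `f ≥ lκ` the factor is not
positive. Where `f < lκ`, either `w ≤ 2lκ`, or `|f - w| ≥ lκ` and `w² ≤ κ² = (κ / l) * (lκ)` is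
absorbed by the approximation error. -/
theorem min_one_sub_mul_sq_le {z f w κ l : ℝ} (hz : z ≤ 1) (hw : 0 ≤ w) (hwκ : w ≤ κ)
    (hl : 0 < l) (hκ : 0 < κ) :
    min z (max 0 (1 - (l * κ)⁻¹ * f)) * w ^ 2 ≤ 4 * l ^ 2 * κ ^ 2 + κ / l * |f - w| := by
  have hnn : 0 ≤ κ / l * |f - w| := by positivity
  by_cases hf : l * κ ≤ f
  · have : max 0 (1 - (l * κ)⁻¹ * f) = 0 := by
      refine max_eq_left ?_
      rw [inv_mul_eq_div, sub_nonpos, one_le_div (by positivity)]; exact hf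
    have h1 : min z (max 0 (1 - (l * κ)⁻¹ * f)) ≤ 0 :=
      (min_le_right _ _).trans this.le
    have h2 := mul_nonpos_of_nonpos_of_nonneg h1 (sq_nonneg w)
    have : 0 ≤ 4 * l ^ 2 * κ ^ 2 := by positivity
    linarith
  · have h1 : min z (max 0 (1 - (l * κ)⁻¹ * f)) * w ^ 2 ≤ w ^ 2 :=
      mul_le_of_le_one_left (sq_nonneg w) ((min_le_left _ _).trans hz)
    by_cases h2 : w ≤ 2 * (l * κ)
    · have : w ^ 2 ≤ (2 * (l * κ)) ^ 2 := pow_le_pow_left₀ hw h2 2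
      linarith
    · have h3 : l * κ ≤ |f - w| := by rw [abs_sub_comm]; exact le_trans (by linarith) (le_abs_self _)
      have h4 : κ / l * (l * κ) ≤ κ / l * |f - w| := by gcongr
      have h5 : κ / l * (l * κ) = κ ^ 2 := by field_simp
      have h6 : w ^ 2 ≤ κ ^ 2 := pow_le_pow_left₀ hw hwκ 2
      have : 0 ≤ 4 * l ^ 2 * κ ^ 2 := by positivity
      linarith

end Truncation

/-! ### Propagation in time from a good slice -/

section Propagation

variable {X : Type*} [MetricSpace X] [ProperSpace X] [MeasurableSpace X] [BorelSpace X]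
  {μ : Measure X} [IsLocallyFiniteMeasure μ] {Ω : Set X} {T γ : ℝ} {u : X → ℝ → ℝ} {y : X} {r : ℝ}

/-- Propagation of smallness of `(u - k)_-` from the time `s₀` to a later time `t`. -/
theorem DGminus.measure_le_of_totalVariation_lt (hu : DGminus μ Ω T γ u) (hr : 0 < r)
    (hU : closedBall y r ⊆ Ω) {t₀ t₁ : ℝ} (ht₀ : 0 < t₀) (ht₁ : t₁ ≤ T) {k κ : ℝ} (hκ : 0 < κ)
    (hb : ∀ᵐ p ∂((μ.prod volume).restrict (ball y r ×ˢ Ioo t₀ t₁)),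
      negPart (u p.1 p.2 - k) ≤ κ)
    {s₀ t : ℝ} (hs₀ : t₀ < s₀) (hst : s₀ < t) (ht : t < t₁)
    (hbs : ∀ᵐ x ∂(μ.restrict (ball y r)), negPart (u x s₀ - k) ≤ κ)
    {ζ η : X → ℝ} (hζ : IsSpatialCutoff y r ζ) {L : ℝ≥0} (hζL : LipschitzWith L ζ)
    {K : Set X} (hK : IsCompact K) (hKU : K ⊆ ball y r) (hζK : ∀ x ∉ K, ζ x = 0)
    (hηK : ∀ x ∈ K, η x = 1) {B : Set X} (hBK : B ⊆ K) (hζB : ∀ x ∈ B, ζ x = 1) {M : ℝ≥0∞}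
    (hM : totalVariation μ (fun x => η x * negPart (u x s₀ - k)) (ball y r) < M)
    {l : ℝ} (hl : 0 < l) {e : ℝ≥0∞} (he : 0 < e) :
    μ B ≤ μ (B ∩ {x | l * κ / 2 ≤ negPart (u x s₀ - k)}) + ENNReal.ofReal (4 / (l * κ)) * e
      + μ (B ∩ {x | negPart (u x t - k) ≤ κ / 2})
      + ENNReal.ofReal (16 / κ ^ 2) * (ENNReal.ofReal γ * ENNReal.ofReal κ *
          (ENNReal.ofReal (l * κ)⁻¹ * M + L * μ (ball y r)) * ENNReal.ofReal (t - s₀)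
        + (ENNReal.ofReal (4 * l ^ 2 * κ ^ 2) * μ K + ENNReal.ofReal (κ / l) * e)) := by
  obtain ⟨F, g, hF, hg, hFe, hgM⟩ := exists_lipLoc_of_totalVariation_lt hM hK hKU he
  set φ : X → ℝ := fun x => min (ζ x) (max 0 (1 - (l * κ)⁻¹ * F x)) with hφdef
  have hφ : IsSpatialCutoff y r φ := hζ.min_one_sub hF _
  have hφg := hg.of_abs_sub_le (φ := φ) (a := (l * κ)⁻¹) (L := L) (by positivity) L.coe_nonneg
    (fun x _ z _ => abs_min_one_sub_sub_le hζL (by positivity) x z)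
  have hs₀T : s₀ ∈ Ioo 0 T := ⟨ht₀.trans hs₀, (hst.trans ht).trans_le ht₁⟩
  have htT : t ∈ Ioo 0 T := ⟨hs₀T.1.trans hst, ht.trans_le ht₁⟩
  have hint : ∫⁻ x in K, ENNReal.ofReal |F x - negPart (u x s₀ - k)| ∂μ < e := by
    refine lt_of_le_of_lt (le_of_eq (setLIntegral_congr_fun hK.measurableSet fun x hx => ?_)) hFe
    simp [hηK x hx]
  have hE₀ : energy μ u (fun x _ => φ x) k y r s₀
      ≤ ENNReal.ofReal (4 * l ^ 2 * κ ^ 2) * μ K + ENNReal.ofReal (κ / l) * e := by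
    calc energy μ u (fun x _ => φ x) k y r s₀
        ≤ ∫⁻ x in ball y r, K.indicator (fun x => ENNReal.ofReal (4 * l ^ 2 * κ ^ 2)
            + ENNReal.ofReal (κ / l) * ENNReal.ofReal |F x - negPart (u x s₀ - k)|) x ∂μ := by
          refine lintegral_mono_ae (hbs.mono fun x hx => ?_)
          by_cases hxK : x ∈ K
          · rw [indicator_of_mem hxK, ← ENNReal.ofReal_mul (by positivity),
              ← ENNReal.ofReal_add (by positivity) (by positivity)]
            exact ENNReal.ofReal_le_ofReal
              (min_one_sub_mul_sq_le (hζ.le_one x) (negPart_nonneg _) hx hl hκ)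
          · have : φ x = 0 := by simp [hφdef, hζK x hxK]
            simp [this]
      _ = ENNReal.ofReal (4 * l ^ 2 * κ ^ 2) * μ K + ENNReal.ofReal (κ / l) *
            ∫⁻ x in K, ENNReal.ofReal |F x - negPart (u x s₀ - k)| ∂μ := by
          rw [lintegral_indicator hK.measurableSet, Measure.restrict_restrict hK.measurableSet,
            inter_eq_left.2 hKU, lintegral_add_left measurable_const,
            lintegral_const_mul' _ _ ENNReal.ofReal_ne_top, lintegral_const,
            Measure.restrict_apply_univ]
      _ ≤ _ := by gcongr
  have hE : energy μ u (fun x _ => φ x) k y r t ≤ ENNReal.ofReal γ * ENNReal.ofReal κ *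
          (ENNReal.ofReal (l * κ)⁻¹ * M + L * μ (ball y r)) * ENNReal.ofReal (t - s₀)
        + (ENNReal.ofReal (4 * l ^ 2 * κ ^ 2) * μ K + ENNReal.ofReal (κ / l) * e) := by
    refine (le_add_right (le_max_right _ _)).trans
      ((hu.ineq_of_bound hr hU ht₀ ht₁ hb hφ hφg hs₀.le hst ht).trans ?_)
    rw [lintegral_add_right _ measurable_const, lintegral_const_mul' _ _ ENNReal.ofReal_ne_top,
      lintegral_const, Measure.restrict_apply_univ, ENNReal.ofReal_coe_nnreal]
    gcongr
  -- Chebyshev's inequality for the L¹ error of `F`.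
  have hbad : μ (K ∩ {x | l * κ / 4 ≤ |F x - negPart (u x s₀ - k)|})
      ≤ ENNReal.ofReal (4 / (l * κ)) * e := by
    obtain ⟨CF, hCF⟩ := hF K hKU hK
    have hm : AEMeasurable (fun x => ENNReal.ofReal |F x - negPart (u x s₀ - k)|)
        (μ.restrict K) :=
      (measurable_abs.comp_aemeasurable ((hCF.continuousOn.aemeasurable hK.measurableSet).sub
        ((hu.aemeasurable_slice hU hs₀T k).mono_measure
          (Measure.restrict_mono hKU le_rfl)))).ennreal_ofReal
    have h1 := mul_meas_ge_le_lintegral₀ hm (ENNReal.ofReal (l * κ / 4))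
    have h2 : μ (K ∩ {x | l * κ / 4 ≤ |F x - negPart (u x s₀ - k)|})
        ≤ (μ.restrict K) {x | ENNReal.ofReal (l * κ / 4)
          ≤ ENNReal.ofReal |F x - negPart (u x s₀ - k)|} := by
      refine le_trans (measure_mono (t := _ ∩ K) ?_) (Measure.le_restrict_apply K _)
      exact fun x hx => ⟨ENNReal.ofReal_le_ofReal hx.2, hx.1⟩
    calc _ = ENNReal.ofReal (4 / (l * κ)) * (ENNReal.ofReal (l * κ / 4)
            * μ (K ∩ {x | l * κ / 4 ≤ |F x - negPart (u x s₀ - k)|})) := by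
          rw [← mul_assoc (ENNReal.ofReal _), ← ENNReal.ofReal_mul (by positivity),
            show 4 / (l * κ) * (l * κ / 4) = 1 by field_simp, ENNReal.ofReal_one, one_mul]
      _ ≤ _ := mul_le_mul' le_rfl (((mul_le_mul' le_rfl h2).trans h1).trans hint.le)
  have hgood : μ (B ∩ {x | F x ≤ 3 / 4 * (l * κ) ∧ κ / 2 < negPart (u x t - k)})
      ≤ ENNReal.ofReal (16 / κ ^ 2) * energy μ u (fun x _ => φ x) k y r t := by
    have hφm : AEMeasurable φ (μ.restrict (ball y r)) := by
      obtain ⟨C, hC⟩ := hφ.lipschitz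
      exact hC.continuous.measurable.aemeasurable
    have h1 := mul_meas_ge_le_lintegral₀
      ((hφm.mul ((hu.aemeasurable_slice hU htT k).pow_const 2)).ennreal_ofReal)
      (ENNReal.ofReal (κ ^ 2 / 16))
    have h2 : μ (B ∩ {x | F x ≤ 3 / 4 * (l * κ) ∧ κ / 2 < negPart (u x t - k)})
        ≤ (μ.restrict (ball y r)) {x | ENNReal.ofReal (κ ^ 2 / 16) ≤ ENNReal.ofReal
            ((φ * fun x => negPart (u x t - k) ^ 2) x)} := by
      refine le_trans (measure_mono (t := _ ∩ ball y r) ?_)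
        (Measure.le_restrict_apply (ball y r) _)
      rintro x ⟨hxB, hxF, hxw⟩
      refine ⟨ENNReal.ofReal_le_ofReal ?_, hKU (hBK hxB)⟩
      -- On `B` we have ζ = 1, and `F ≤ 3/4 * lκ` leaves `1 - F / (lκ) ≥ 1/4`.
      have hφx : 1 / 4 ≤ φ x := by
        refine le_min (by rw [hζB x hxB]; norm_num) (le_max_of_le_right ?_)
        have : (l * κ)⁻¹ * F x ≤ 3 / 4 := by
          rw [inv_mul_eq_div, div_le_iff₀ (by positivity)]; exact hxF
        linarith
      calc κ ^ 2 / 16 = 1 / 4 * (κ / 2) ^ 2 := by ring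
        _ ≤ φ x * negPart (u x t - k) ^ 2 := by gcongr
    calc _ = ENNReal.ofReal (16 / κ ^ 2) * (ENNReal.ofReal (κ ^ 2 / 16)
            * μ (B ∩ {x | F x ≤ 3 / 4 * (l * κ) ∧ κ / 2 < negPart (u x t - k)})) := by
          rw [← mul_assoc (ENNReal.ofReal _), ← ENNReal.ofReal_mul (by positivity),
            show 16 / κ ^ 2 * (κ ^ 2 / 16) = 1 by field_simp, ENNReal.ofReal_one, one_mul]
      _ ≤ _ := mul_le_mul' le_rfl ((mul_le_mul' le_rfl h2).trans h1)
  -- Outside the first two sets `F < lκ/2 + lκ/4`, the threshold used in `hgood`.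
  have hcover : B ⊆ ((B ∩ {x | l * κ / 2 ≤ negPart (u x s₀ - k)})
      ∪ (K ∩ {x | l * κ / 4 ≤ |F x - negPart (u x s₀ - k)|})
      ∪ (B ∩ {x | negPart (u x t - k) ≤ κ / 2}))
      ∪ (B ∩ {x | F x ≤ 3 / 4 * (l * κ) ∧ κ / 2 < negPart (u x t - k)}) := by
    intro x hx
    by_cases h1 : l * κ / 2 ≤ negPart (u x s₀ - k)
    · exact Or.inl (Or.inl (Or.inl ⟨hx, h1⟩))
    by_cases h2 : l * κ / 4 ≤ |F x - negPart (u x s₀ - k)|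
    · exact Or.inl (Or.inl (Or.inr ⟨hBK hx, h2⟩))
    by_cases h3 : negPart (u x t - k) ≤ κ / 2
    · exact Or.inl (Or.inr ⟨hx, h3⟩)
    refine Or.inr ⟨hx, ?_, not_le.1 h3⟩
    have := le_abs_self (F x - negPart (u x s₀ - k))
    linarith
  refine (measure_mono hcover).trans ((measure_union_le _ _).trans (add_le_add
    ((measure_union_le _ _).trans (add_le_add ((measure_union_le _ _).trans
      (add_le_add le_rfl hbad)) le_rfl)) (hgood.trans ?_)))
  gcongr

end Propagation

/-! ### Compact superlevel sets and the choice of constants -/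

section Main

variable {X : Type*} [MetricSpace X] [ProperSpace X] [MeasurableSpace X] [BorelSpace X]
  {μ : Measure X} [IsLocallyFiniteMeasure μ] {Ω : Set X} {T γ : ℝ} {u : X → ℝ → ℝ} {y : X} {r : ℝ}

theorem DGminus.exists_isCompact_superlevel (hu : DGminus μ Ω T γ u) (hU : closedBall y r ⊆ Ω)
    {t : ℝ} (ht : t ∈ Ioo 0 T) (k : ℝ) {ρ : ℝ} (hρ : ρ ≤ r) {e : ℝ≥0∞} (he : e ≠ 0) :
    ∃ K, IsCompact K ∧ K ⊆ {x ∈ ball y ρ | k ≤ u x t} ∧ μ {x ∈ ball y ρ | k ≤ u x t} ≤ μ K + e := by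
  have hnull : NullMeasurableSet {x ∈ ball y ρ | k ≤ u x t} μ := by
    have h1 := (hu.aemeasurable_slice hU ht k).mono_measure
      (Measure.restrict_mono (ball_subset_ball hρ) le_rfl)
    -- The class makes only the truncations of a slice measurable; the superlevel set is the zero
    -- set of the truncation at level `k`.
    have h2 := h1.nullMeasurable (measurableSet_Iic (a := (0 : ℝ)))
    rw [nullMeasurableSet_restrict measurableSet_ball.nullMeasurableSet] at h2
    convert h2 using 1
    ext x
    simp [negPart, and_comm]
  obtain ⟨G, hG, hGm, hGeq⟩ := hnull.exists_measurable_subset_ae_eq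
  have hfin : μ G ≠ ∞ := ne_top_of_le_ne_top (measure_ball_lt_top (μ := μ) (x := y) (r := ρ)).ne
    (measure_mono fun x hx => (hG hx).1)
  obtain ⟨K, hKG, hK, hlt⟩ := hGm.exists_isCompact_lt_add hfin he
  exact ⟨K, hK, hKG.trans hG, (measure_congr hGeq).symm.le.trans hlt.le⟩

/-- The numerical balance of the final estimate, with `l = 1 / (64C)`. The losses are m/32 for K
inside the superlevel set, m/32 from t₀ to s₀, m/320 for Chebyshev on `F`, and m/32 + m/64 + m/80
for gradient, initial energy and approximation error in the energy at `t`: altogether m/8. The value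
of δ is what the gradient term requires. -/
theorem propagation_constant_le {C γ δ m κ ρ h : ℝ} (hC : 1 ≤ C) (hγ : 0 < γ)
    (hδ : δ = 1 / (2 + 512 * γ * C * (1024 * γ * C + 4))) (hm : 0 < m) (hκ : 0 < κ) (hρ : 0 < ρ)
    (hh : h ≤ δ * κ * ρ) :
    m / 32 + (m / 32 + 4 / (1 / (64 * C) * κ) * (m * (1 / (64 * C)) * κ / 1280)
      + 16 / κ ^ 2 * (γ * κ * ((1 / (64 * C) * κ)⁻¹ * (2 * (γ * κ * ((ρ / 8)⁻¹ * (C * m))))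
          + (ρ / 4)⁻¹ * (C * m)) * h
        + (4 * (1 / (64 * C)) ^ 2 * κ ^ 2 * (C * m)
          + κ / (1 / (64 * C)) * (m * (1 / (64 * C)) * κ / 1280)))) ≤ m / 4 := by
  have hC0 : 0 < C := by linarith
  have h1 : 4 / (1 / (64 * C) * κ) * (m * (1 / (64 * C)) * κ / 1280) = m / 320 := by
    field_simp; ring
  have h2 : 16 / κ ^ 2 * (κ / (1 / (64 * C)) * (m * (1 / (64 * C)) * κ / 1280)) = m / 80 := by
    field_simp; ring
  have h3 : 16 / κ ^ 2 * (4 * (1 / (64 * C)) ^ 2 * κ ^ 2 * (C * m)) ≤ m / 64 := by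
    have : 16 / κ ^ 2 * (4 * (1 / (64 * C)) ^ 2 * κ ^ 2 * (C * m)) = m / (64 * C) := by
      field_simp; ring
    rw [this]
    gcongr
    linarith
  have h4 : 16 / κ ^ 2 * (γ * κ * ((1 / (64 * C) * κ)⁻¹ * (2 * (γ * κ * ((ρ / 8)⁻¹ * (C * m))))
          + (ρ / 4)⁻¹ * (C * m)) * h) ≤ m / 32 := by
    calc _ = 16 * γ * C * (1024 * γ * C + 4) * m * (h / (κ * ρ)) := by field_simp; ring
      _ ≤ 16 * γ * C * (1024 * γ * C + 4) * m * δ := by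
          gcongr
          rw [div_le_iff₀ (by positivity)]; linarith
      _ = m / 32 * (512 * γ * C * (1024 * γ * C + 4) / (2 + 512 * γ * C * (1024 * γ * C + 4))) := by
          rw [hδ]; ring
      _ ≤ m / 32 * 1 := by
          gcongr
          rw [div_le_one (by positivity)]; linarith
      _ = m / 32 := mul_one _
  rw [mul_add (16 / κ ^ 2), mul_add (16 / κ ^ 2), h1, h2]
  linarith

end Main

end MetricTV
end


/-! ### The main lemma -/

theorem lemma6p1 :
    ∃ ε ∈ Set.Ioo (0 : ℝ) 1, ∀ Cμ γ : ℝ, 1 ≤ Cμ → 0 < γ →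
    ∃ δ ∈ Set.Ioo (0 : ℝ) 1,
    ∀ (X : Type*) [MetricSpace X] [CompleteSpace X] [MeasurableSpace X] [BorelSpace X]
      (μ : MeasureTheory.Measure X) (Ω : Set X) (T : ℝ) (u : X → ℝ → ℝ),
      MetricTV.IsDoubling μ Cμ → MetricTV.SupportsPoincare μ → IsOpen Ω → 0 < T →
      MetricTV.DGminus μ Ω T γ u →
    ∀ (x₀ : X) (t₀ ρ ξ mplus mminus ω : ℝ),
      (x₀, t₀) ∈ MetricTV.spaceTime Ω T → 0 < ρ → ξ ∈ Set.Ioo (0 : ℝ) 1 →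
      MetricTV.forwardCylinder x₀ t₀ ρ (δ * ξ * ω) ⊆ MetricTV.spaceTime Ω T →
      (∀ᵐ p ∂((μ.prod MeasureTheory.volume).restrict
        (MetricTV.forwardCylinder x₀ t₀ ρ (δ * ξ * ω))), u p.1 p.2 ≤ mplus) →
      (∀ᵐ p ∂((μ.prod MeasureTheory.volume).restrict
        (MetricTV.forwardCylinder x₀ t₀ ρ (δ * ξ * ω))), mminus ≤ u p.1 p.2) →
      mplus - mminus ≤ ω →
      (1 / 2 : ENNReal) * μ (Metric.ball x₀ ρ)
        ≤ μ {x ∈ Metric.ball x₀ ρ | mminus + ξ * ω ≤ u x t₀} →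
    ∀ t ∈ Set.Ioo t₀ (t₀ + δ * ξ * ω * ρ),
      (1 / 4 : ENNReal) * μ (Metric.ball x₀ ρ)
        ≤ μ {x ∈ Metric.ball x₀ ρ | mminus + ε * ξ * ω ≤ u x t} := by
  refine ⟨1 / 2, by norm_num, fun C γ hC hγ => ?_⟩
  have hC0 : 0 < C := by linarith
  obtain ⟨δ, hδ⟩ : ∃ δ : ℝ, δ = 1 / (2 + 512 * γ * C * (1024 * γ * C + 4)) := ⟨_, rfl⟩
  have hδ0 : 0 < δ := by rw [hδ]; positivity
  have hδ1 : δ < 1 := by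
    have : 0 < 512 * γ * C * (1024 * γ * C + 4) := by positivity
    rw [hδ, div_lt_one (by positivity)]; linarith
  refine ⟨δ, ⟨hδ0, hδ1⟩, ?_⟩
  intro X _ _ _ _ μ Ω T u hdoub _ _ _ hu x₀ t₀ ρ ξ mplus m₀ ω ht₀ hρ _ hsub _ hlow _ hhalf t ht
  have ht₀' : t₀ ∈ Ioo 0 T := ht₀.2
  have := hdoub.properSpace
  have := hdoub.isLocallyFiniteMeasure
  obtain ⟨κ, hκdef⟩ : ∃ κ, κ = ξ * ω := ⟨_, rfl⟩
  have hδκ : δ * ξ * ω = δ * κ := by rw [hκdef]; ring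
  have hεκ : (1 / 2 : ℝ) * ξ * ω = κ / 2 := by rw [hκdef]; ring
  rw [hδκ] at hsub hlow ht
  rw [← hκdef] at hhalf
  rw [hεκ]
  -- The sign of ω is not assumed; positivity comes from the time interval containing `t`.
  have hκ : 0 < κ := by
    have h1 : 0 < δ * κ * ρ := by linarith [ht.1, ht.2]
    exact pos_of_mul_pos_right (pos_of_mul_pos_left h1 hρ.le) hδ0.le
  obtain ⟨t₁, ht₁⟩ : ∃ t₁, t₁ = t₀ + δ * κ * ρ := ⟨_, rfl⟩
  rw [← ht₁] at ht
  have hcyl : MetricTV.forwardCylinder x₀ t₀ ρ (δ * κ) = ball x₀ (2 * ρ) ×ˢ Ioo t₀ t₁ := by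
    rw [MetricTV.forwardCylinder, ht₁]
  rw [hcyl] at hsub hlow
  have hball : ball x₀ (2 * ρ) ⊆ Ω := fun x hx => (hsub (mk_mem_prod hx ht)).1
  have ht₁T : t₁ ≤ T := by
    by_contra! hlt
    obtain ⟨s, hs1, hs2⟩ := exists_between (max_lt hlt ht.2)
    have h1 : ((x₀, s) : X × ℝ) ∈ ball x₀ (2 * ρ) ×ˢ Ioo t₀ t₁ :=
      ⟨mem_ball_self (by positivity), ht.1.trans ((le_max_right _ _).trans_lt hs1), hs2⟩
    have h2 := (hsub h1).2.2
    exact absurd h2 (not_lt.2 ((le_max_left _ _).trans hs1.le))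
  -- Radii: ζ is 1 on the closed ρ-ball and lives in the closed 5ρ/4-ball; η is 1 there and lives in
  -- the closed 11ρ/8-ball. As r < 2ρ, the closed r-ball is a compact subset of Ω.
  obtain ⟨r, hr⟩ : ∃ r, r = 3 / 2 * ρ := ⟨_, rfl⟩
  have hr0 : 0 < r := by rw [hr]; positivity
  have hU : closedBall x₀ r ⊆ Ω := (closedBall_subset_ball (by rw [hr]; linarith)).trans hball
  obtain ⟨k, hk⟩ : ∃ k, k = m₀ + κ := ⟨_, rfl⟩
  have hb : ∀ᵐ p ∂((μ.prod volume).restrict (ball x₀ r ×ˢ Ioo t₀ t₁)),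
      MetricTV.negPart (u p.1 p.2 - k) ≤ κ := by
    refine (ae_restrict_of_ae_restrict_of_subset (Set.prod_mono
      (ball_subset_ball (by rw [hr]; linarith)) le_rfl) hlow).mono fun p hp => max_le ?_ hκ.le
    linarith
  have hP : ∀ᵐ s ∂(volume.restrict (Ioo t₀ t₁)), ∀ᵐ x ∂(μ.restrict (ball x₀ r)),
      MetricTV.negPart (u x s - k) ≤ κ := by
    rw [← Measure.prod_restrict] at hb
    exact Measure.ae_ae_of_ae_prod (Measure.measurePreserving_swap.quasiMeasurePreserving.ae hb)
  obtain ⟨m, hm⟩ : ∃ m, m = (μ (ball x₀ ρ)).toReal := ⟨_, rfl⟩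
  have hμB : μ (ball x₀ ρ) = ENNReal.ofReal m := by
    rw [hm, ENNReal.ofReal_toReal (hdoub x₀ ρ hρ).2.1.ne]
  have hm0 : 0 < m := by
    rw [hm]; exact ENNReal.toReal_pos (hdoub x₀ ρ hρ).1.ne' (hdoub x₀ ρ hρ).2.1.ne
  have hμ2 : μ (ball x₀ (2 * ρ)) ≤ ENNReal.ofReal (C * m) := by
    rw [ENNReal.ofReal_mul hC0.le, ← hμB]; exact (hdoub x₀ ρ hρ).2.2
  have hhalf' : ENNReal.ofReal (m / 2) ≤ μ {x ∈ ball x₀ ρ | k ≤ u x t₀} := by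
    rw [hk]
    refine le_trans (le_of_eq ?_) hhalf
    rw [hμB, div_eq_inv_mul, ENNReal.ofReal_mul (by norm_num), one_div,
      ENNReal.ofReal_inv_of_pos (by norm_num)]
    norm_num
  obtain ⟨K, hK, hKsub, hKμ⟩ := hu.exists_isCompact_superlevel hU ht₀' k
    (show ρ ≤ r by rw [hr]; linarith) (e := ENNReal.ofReal (m / 32)) (by simpa using hm0)
  have hKne : K.Nonempty := by
    by_contra hne
    rw [not_nonempty_iff_eq_empty] at hne
    rw [hne, measure_empty, zero_add] at hKμ
    have := (ENNReal.ofReal_le_ofReal_iff (by positivity)).1 (hhalf'.trans hKμ)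
    linarith
  have hKB : K ⊆ closedBall x₀ ρ := fun x hx => ball_subset_closedBall (hKsub hx).1
  have hK0 : ∀ x ∈ K, MetricTV.negPart (u x t₀ - k) = 0 := fun x hx =>
    max_eq_right (by linarith [(hKsub hx).2])
  obtain ⟨l, hl⟩ : ∃ l, l = 1 / (64 * C) := ⟨_, rfl⟩
  have hl0 : 0 < l := by rw [hl]; positivity
  have hev := hu.eventually_measure_le hr0 hU ht₀'.1 ht₁T (ht.1.trans ht.2) hb hK hKne
    (show ρ < r by rw [hr]; linarith) hKB hK0 (a := l * κ / 2) (by positivity)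
    (e := ENNReal.ofReal (m / 32)) (by simpa using hm0)
  obtain ⟨τ, hτ, hτev⟩ := (mem_nhdsGT_iff_exists_Ioo_subset' ht.1).1 hev
  set ρ' : ℝ≥0 := ⟨ρ, hρ.le⟩ with hρ'
  have hρ'0 : 0 < ρ' := hρ
  have hρ'c : (ρ' : ℝ) = ρ := rfl
  have hne1 : (closedBall x₀ ρ).Nonempty := ⟨x₀, mem_closedBall_self hρ.le⟩
  have hne2 : (closedBall x₀ (5 / 4 * ρ)).Nonempty := ⟨x₀, mem_closedBall_self (by positivity)⟩
  have hζ := MetricTV.isSpatialCutoff_plateau (r := r) hne1 le_rfl (e := ρ' / 4) (by positivity)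
    (by push_cast; rw [hρ'c, hr]; linarith)
  have hη := MetricTV.isSpatialCutoff_plateau (r := r) hne2 le_rfl (e := ρ' / 8) (by positivity)
    (by push_cast; rw [hρ'c, hr]; linarith)
  have hμU : μ (ball x₀ r) ≤ ENNReal.ofReal (C * m) :=
    (measure_mono (ball_subset_ball (by rw [hr]; linarith))).trans hμ2
  have hμK : μ (closedBall x₀ (5 / 4 * ρ)) ≤ ENNReal.ofReal (C * m) :=
    (measure_mono (closedBall_subset_ball (by linarith))).trans hμ2
  have hinv : ∀ n : ℝ≥0, ((ρ' / n)⁻¹ : ℝ≥0) = (ENNReal.ofReal (ρ / n)⁻¹) := fun n => by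
    rw [← ENNReal.ofReal_coe_nnreal]; simp [hρ'c]
  obtain ⟨R, hR⟩ : ∃ R, R = γ * κ * ((ρ / 8)⁻¹ * (C * m)) := ⟨_, rfl⟩
  have hR0 : 0 < R := by rw [hR]; positivity
  -- The good time lies before `t` and inside the interval (t₀, τ) on which `w` is still small on
  -- most of `K`.
  obtain ⟨s₀, hs₀, hbs, hTV⟩ := hu.exists_totalVariation_lt hr0 hU ht₀'.1 ht₁T hb hη
    (MetricTV.isWeakUpperGradient_of_lipschitzWith (MetricTV.lipschitzWith_plateau _ _))
    (R := ENNReal.ofReal R) (by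
      rw [hR, lintegral_const, Measure.restrict_apply_univ, hinv, ENNReal.ofReal_mul (by positivity),
        ENNReal.ofReal_mul hγ.le, ENNReal.ofReal_mul (p := (ρ / 8)⁻¹) (by positivity)]
      gcongr
      simp) (ENNReal.ofReal_pos.2 hR0) ENNReal.ofReal_lt_top hP
    (τ := min τ t) ⟨lt_min hτ ht.1, (min_le_right _ _).trans_lt ht.2⟩
  have hs₀t : s₀ < t := hs₀.2.trans_le (min_le_right _ _)
  have hmain := hu.measure_le_of_totalVariation_lt hr0 hU ht₀'.1 ht₁T hκ hb hs₀.1 hs₀t ht.2 hbs hζ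
    (MetricTV.lipschitzWith_plateau _ _) (isCompact_closedBall x₀ (5 / 4 * ρ))
    (closedBall_subset_ball (by rw [hr]; linarith))
    (fun x hx => MetricTV.plateau_eq_zero_of_notMem_closedBall hne1 (by positivity) le_rfl (by
      push_cast; rwa [hρ'c, show ρ + ρ / 4 = 5 / 4 * ρ by ring]))
    (fun x hx => MetricTV.plateau_of_mem _ hx)
    (hKB.trans (closedBall_subset_closedBall (by linarith)))
    (fun x hx => MetricTV.plateau_of_mem _ (hKB hx)) hTV hl0
    (e := ENNReal.ofReal (m * l * κ / 1280)) (ENNReal.ofReal_pos.2 (by positivity))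
  have hsmall : μ (K ∩ {x | l * κ / 2 ≤ MetricTV.negPart (u x s₀ - k)}) ≤ ENNReal.ofReal (m / 32) :=
    hτev ⟨hs₀.1, hs₀.2.trans_le (min_le_left _ _)⟩
  have htarget : K ∩ {x | MetricTV.negPart (u x t - k) ≤ κ / 2}
      ⊆ {x ∈ ball x₀ ρ | m₀ + κ / 2 ≤ u x t} := fun x hx =>
    ⟨(hKsub hx.1).1, by
      have : -(u x t - k) ≤ κ / 2 := (le_max_left _ _).trans hx.2
      linarith⟩
  have hconst := MetricTV.propagation_constant_le hC hγ hδ hm0 hκ hρ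
    (show t - s₀ ≤ δ * κ * ρ by linarith [hs₀.1, ht.2])
  rw [← hl, ← hR] at hconst
  have hts : 0 < t - s₀ := sub_pos.2 hs₀t
  have hbound : ENNReal.ofReal (m / 2)
      ≤ ENNReal.ofReal (m / 4) + μ {x ∈ ball x₀ ρ | m₀ + κ / 2 ≤ u x t} := by
    refine (hhalf'.trans (hKμ.trans (add_le_add hmain le_rfl))).trans ?_
    refine le_trans ?_ (add_le_add (ENNReal.ofReal_le_ofReal hconst) le_rfl)
    -- Distributes `ENNReal.ofReal` over the real bound, so that its terms match those of `hmain`.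
    rw [ENNReal.ofReal_add (by positivity) (by positivity),
      ENNReal.ofReal_add (by positivity) (by positivity),
      ENNReal.ofReal_add (by positivity) (by positivity),
      ENNReal.ofReal_mul (p := 4 / (l * κ)) (by positivity),
      ENNReal.ofReal_mul (p := 16 / κ ^ 2) (by positivity),
      ENNReal.ofReal_add (by positivity) (by positivity),
      ENNReal.ofReal_mul (q := t - s₀) (by positivity),
      ENNReal.ofReal_mul (p := γ * κ) (by positivity),
      ENNReal.ofReal_mul hγ.le,
      ENNReal.ofReal_add (by positivity) (by positivity),
      ENNReal.ofReal_mul (p := (l * κ)⁻¹) (by positivity),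
      ENNReal.ofReal_mul (p := 2) (by positivity),
      ENNReal.ofReal_mul (p := (ρ / 4)⁻¹) (by positivity),
      ENNReal.ofReal_add (by positivity) (by positivity),
      ENNReal.ofReal_mul (p := 4 * l ^ 2 * κ ^ 2) (by positivity),
      ENNReal.ofReal_mul (p := κ / l) (by positivity), hinv, ENNReal.ofReal_ofNat,
      add_comm _ (ENNReal.ofReal (m / 32)), add_assoc (ENNReal.ofReal (m / 32))]
    refine add_le_add le_rfl ?_
    rw [add_right_comm _ (μ (K ∩ {x | MetricTV.negPart (u x t - k) ≤ κ / 2}))]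
    exact add_le_add (by gcongr; exact le_rfl) (measure_mono htarget)
  have hfin : ENNReal.ofReal (m / 4) ≠ ∞ := ENNReal.ofReal_ne_top
  have hsum : ENNReal.ofReal (m / 2) = ENNReal.ofReal (m / 4) + ENNReal.ofReal (m / 4) := by
    rw [← ENNReal.ofReal_add (by positivity) (by positivity)]; congr 1; ring
  rw [hsum] at hbound
  refine le_trans (le_of_eq ?_) ((ENNReal.add_le_add_iff_left hfin).1 hbound)
  rw [hμB, div_eq_inv_mul m, ENNReal.ofReal_mul (by norm_num), one_div,
    ENNReal.ofReal_inv_of_pos (by norm_num)]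
  norm_num
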